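/- Formulae are built from literals (propositional variables and their duals) with $\top,\bot,\wedge,\vee$; $\bar A$ denotes the De Morgan dual of $A$. The deep inference system $\mathsf{KS}$ has the rules (premiss $\to$ conclusion) $$\top\to a\vee\bar a,\qquad \bot\to a,\qquad a\vee a\to a,\qquad A\wedge(B\vee C)\to(A\wedge B)\vee C,\qquad (A\wedge B)\vee(C\wedge D)\to(A\vee C)\wedge(B\vee D),$$ for literals $a$ and formulae $A,B,C,D$, together with the rule $A\to B$ whenever $A=B$ in the congruence generated by associativity and commutativity of $\wedge$ and $\vee$ and by $A\vee\bot=A$, $A\wedge\top=A$, $\top\vee\top=\top$, $\bot\wedge\bot=\bot$. Derivations are generated from formulae by composing derivations with $\wedge$, with $\vee$, and vertically by an instance of a rule; a proof of $A$ is a derivation with premiss $\top$ and conclusion $A$, and its size is its number of atom occurrences. A term is a conjunction of literals (up to order and bracketing), and its size is its number of literal occurrences. In Resolution$(f)$, for $f:\mathbb N\to\mathbb N$, the lines are sets of terms $\Gamma,\Delta,\dots$, standing for the disjunction of their elements; in multiset-Resolution$(f)$ they are multisets. The rules are: from $\Gamma$ infer $\Gamma\cup\Delta$; from $\Gamma\cup\{s\}$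 and $\Delta\cup\{t\}$ infer $\Gamma\cup\Delta\cup\{s\wedge t\}$; from $\Gamma\cup\{a_1\wedge\dots\wedge a_k\}$ and $\Delta\cup\{\bar a_1,\dots,\bar a_k\}$ infer $\Gamma\cup\Delta$. A refutation of $A=\bigwedge_{r}\bigvee\Gamma_r$ is a list of (multi)sets of terms, each of them given as some $\Gamma_r$ or as the conclusion of a rule from indicated earlier lines, whose last entry is $\emptyset$ and in which no term has size greater than $f(N)$, where $N$ is the number of inference steps of the refutation. It is tree-like if every line is used at most once as a premiss. **Theorem.** For every function $f:\mathbb N\to\mathbb N$: 1. $\mathsf{KS}$ polynomially simulates multiset-Resolution$(f)$; 2. $\mathsf{KS}$ polynomially simulates tree-like Resolution$(f)$ (operating on sets). That is, in each case there is a polynomial-time algorithm that transforms every refutation of a formula $A=\bigwedge_r\bigvee\Gamma_r$ in the system concerned into a $\mathsf{KS}$ proof (hence one of polynomial size) of $\bar A$. -/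

import Mathlib

namespace DeepInf

/-! ### Formulae in negation normal form -/

/-- A literal (atom): a propositional variable or its dual. -/
structure Literal where
  var : ℕ
  pos : Bool
  deriving DecidableEq

/-- The dual literal. -/
def Literal.dual (a : Literal) : Literal := ⟨a.var, !a.pos⟩

/-- Formulae over the basis `⊤, ⊥, ∧, ∨`, built from literals. -/
inductive Formula where
  | top : Formula
  | bot : Formula
  | lit (a : Literal) : Formula
  | and (A B : Formula) : Formula
  | or (A B : Formula) : Formula

namespace Formula

/-- The De Morgan dual. -/
def dual : Formula → Formula
  | top => bot
  | bot => top
  | lit a => lit a.dual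
  | and A B => or A.dual B.dual
  | or A B => and A.dual B.dual

/-- The number of atom occurrences. -/
def size : Formula → ℕ
  | top => 0
  | bot => 0
  | lit _ => 1
  | and A B => A.size + B.size
  | or A B => A.size + B.size

/-- Conjunction of a list of formulae; the empty conjunction is `⊤`. -/
def bigAnd : List Formula → Formula
  | [] => top
  | [A] => A
  | A :: B :: l => and A (bigAnd (B :: l))

/-- Disjunction of a list of formulae; the empty disjunction is `⊥`. -/
def bigOr : List Formula → Formula
  | [] => bot
  | [A] => A
  | A :: B :: l => or A (bigOr (B :: l))

/-- The equational theory of the logical rule `=`: commutativity, associativity and the unit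
equations, closed under reflexivity, symmetry, transitivity and contexts. -/
inductive Equal : Formula → Formula → Prop where
  | orComm (A B) : Equal (or A B) (or B A)
  | andComm (A B) : Equal (and A B) (and B A)
  | orAssoc (A B C) : Equal (or (or A B) C) (or A (or B C))
  | andAssoc (A B C) : Equal (and (and A B) C) (and A (and B C))
  | orBot (A) : Equal (or A bot) A
  | andTop (A) : Equal (and A top) A
  | topTop : Equal (or top top) top
  | botBot : Equal (and bot bot) bot
  | refl (A) : Equal A A
  | symm {A B} : Equal A B → Equal B A
  | trans {A B C} : Equal A B → Equal B C → Equal A C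
  | orCongr (C) {A B} : Equal A B → Equal (or C A) (or C B)
  | andCongr (C) {A B} : Equal A B → Equal (and C A) (and C B)

end Formula

/-! ### The deep inference system `KS` -/

/-- The rules of `KS`, together with the logical rule `=` (called `equ`). -/
inductive Rule where
  | identity
  | weakening
  | contraction
  | switch
  | medial
  | equ

/-- `Rule.Inst ρ A B`: there is an instance of the rule `ρ` with premiss `A` and conclusion `B`. -/
inductive Rule.Inst : Rule → Formula → Formula → Prop where
  | identity (a : Literal) : Rule.Inst .identity .top (.or (.lit a) (.lit a.dual))
  | weakening (a : Literal) : Rule.Inst .weakening .bot (.lit a)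
  | contraction (a : Literal) : Rule.Inst .contraction (.or (.lit a) (.lit a)) (.lit a)
  | switch (A B C : Formula) : Rule.Inst .switch (.and A (.or B C)) (.or (.and A B) C)
  | medial (A B C D : Formula) :
      Rule.Inst .medial (.or (.and A B) (.and C D)) (.and (.or A C) (.or B D))
  | equ {A B : Formula} : Formula.Equal A B → Rule.Inst .equ A B

/-- The trees underlying derivations: formulae, compositions by `∧` and `∨`, and vertical
compositions `infer ρ Φ Ψ` (first `Φ`, then a step `ρ` from the conclusion of `Φ` to the premiss
of `Ψ`, then `Ψ`). -/
inductive Deriv where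
  | form (A : Formula) : Deriv
  | and (Φ Ψ : Deriv) : Deriv
  | or (Φ Ψ : Deriv) : Deriv
  | infer (ρ : Rule) (Φ Ψ : Deriv) : Deriv

namespace Deriv

/-- Premiss. -/
def pr : Deriv → Formula
  | form A => A
  | and Φ Ψ => .and Φ.pr Ψ.pr
  | or Φ Ψ => .or Φ.pr Ψ.pr
  | infer _ Φ _ => Φ.pr

/-- Conclusion. -/
def cn : Deriv → Formula
  | form A => A
  | and Φ Ψ => .and Φ.cn Ψ.cn
  | or Φ Ψ => .or Φ.cn Ψ.cn
  | infer _ _ Ψ => Ψ.cn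

/-- Every inference step is a correct instance of its rule; as `Rule` lists the rules of `KS`
and `=`, this says that the tree is a `KS` derivation. -/
def IsKS : Deriv → Prop
  | form _ => True
  | and Φ Ψ => Φ.IsKS ∧ Ψ.IsKS
  | or Φ Ψ => Φ.IsKS ∧ Ψ.IsKS
  | infer ρ Φ Ψ => Φ.IsKS ∧ Ψ.IsKS ∧ ρ.Inst Φ.cn Ψ.pr

/-- The number of atom occurrences in a derivation. -/
def size : Deriv → ℕ
  | form A => A.size
  | and Φ Ψ => Φ.size + Ψ.size
  | or Φ Ψ => Φ.size + Ψ.size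
  | infer _ Φ Ψ => Φ.size + Ψ.size

/-- `Φ` is a `KS` proof of `A`. -/
def IsKSProof (Φ : Deriv) (A : Formula) : Prop :=
  Φ.IsKS ∧ Φ.pr = .top ∧ Φ.cn = A

end Deriv

/-! ### Resolution on (multi)sets of terms -/

/-- A term (conjunction of literals), up to the order of its literals; `s + t` is `s ∧ t`. -/
abbrev Term := Multiset Literal

/-- A term and a (multi)set of terms as they are written down. -/
abbrev TermList := List Literal
abbrev Clause := List TermList

/-- The multiset of terms that a clause lists. -/
def Clause.terms (C : Clause) : Multiset Term :=
  Multiset.ofList (C.map fun t => Multiset.ofList t)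

/-- The two settings: clauses are multisets of terms, or sets of terms. -/
inductive Setting where
  | multiset
  | set

/-- Equality of clauses in each setting. A set of terms is handled as a multiset of which only the
underlying set matters (so that `+` is union of sets). -/
def Setting.Same : Setting → Multiset Term → Multiset Term → Prop
  | .multiset, Γ, Δ => Γ = Δ
  | .set, Γ, Δ => Γ.toFinset = Δ.toFinset

/-- Written clauses list each element of a set only once. -/
def Setting.WellFormed : Setting → Clause → Prop
  | .multiset, _ => True
  | .set, C => C.terms.Nodup

/-- How a line of a derivation is obtained: it is the hypothesis number `r`, or it follows from
the earlier lines number `i`, `j` (counted from `0`) by weakening, `∧`-introduction or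
resolution. -/
inductive Justification where
  | hyp (r : ℕ)
  | wk (i : ℕ)
  | and (i j : ℕ)
  | res (i j : ℕ)

/-- The lines used as premisses, with repetitions. -/
def Justification.premisses : Justification → List ℕ
  | hyp _ => []
  | wk i => [i]
  | and i j => [i, j]
  | res i j => [i, j]

/-- Is the line the conclusion of an inference step (and not a hypothesis)? -/
def Justification.isStep : Justification → Bool
  | hyp _ => false
  | _ => true

/-- A line of a derivation. -/
structure Line where
  clause : Clause
  just : Justification

/-- `Follows S hyps prev J C`: the clause `C` is obtained as described by `J` from the hypotheses
`hyps` and the previous lines `prev`. -/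
inductive Follows (S : Setting) (hyps prev : List (Multiset Term)) :
    Justification → Multiset Term → Prop where
  | hyp {r : ℕ} {G C : Multiset Term} :
      hyps[r]? = some G → S.Same C G → Follows S hyps prev (.hyp r) C
  | wk {i : ℕ} {C Γ Δ : Multiset Term} :
      prev[i]? = some Γ → S.Same C (Γ + Δ) → Follows S hyps prev (.wk i) C
  | and {i j : ℕ} {P Q C Γ Δ : Multiset Term} {s t : Term} :
      prev[i]? = some P → prev[j]? = some Q →
      S.Same P (Γ + {s}) → S.Same Q (Δ + {t}) → S.Same C (Γ + Δ + {s + t}) →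
      Follows S hyps prev (.and i j) C
  | res {i j : ℕ} {P Q C Γ Δ : Multiset Term} {s : Term} :
      prev[i]? = some P → prev[j]? = some Q →
      S.Same P (Γ + {s}) → S.Same Q (Δ + s.map fun a => ({a.dual} : Term)) →
      S.Same C (Γ + Δ) →
      Follows S hyps prev (.res i j) C

/-- `π` is a derivation from the clauses `Γs`. -/
def IsDerivation (S : Setting) (Γs : List Clause) (π : List Line) : Prop :=
  (∀ G ∈ Γs, S.WellFormed G) ∧ (∀ L ∈ π, S.WellFormed L.clause) ∧
  ∀ (m : ℕ) (L : Line), π[m]? = some L →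
    Follows S (Γs.map Clause.terms) ((π.take m).map fun L => L.clause.terms) L.just L.clause.terms

/-- The number of inference steps. -/
def numSteps (π : List Line) : ℕ := π.countP fun L => L.just.isStep

/-- `π` is a refutation of `Γs` by terms of size at most `f N`, where `N` is the number of
inference steps of `π`. -/
def IsRefutation (S : Setting) (f : ℕ → ℕ) (Γs : List Clause) (π : List Line) : Prop :=
  IsDerivation S Γs π ∧
  (∃ L, π.getLast? = some L ∧ L.clause = []) ∧
  ∀ L ∈ π, ∀ t ∈ L.clause, t.length ≤ f (numSteps π)

/-- Every line is used at most once as a premiss. -/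
def IsTreeLike (π : List Line) : Prop := (π.flatMap fun L => L.just.premisses).Nodup

/-- Refutations in multiset-Resolution(f). -/
def MultisetRes (f : ℕ → ℕ) (Γs : List Clause) (π : List Line) : Prop :=
  IsRefutation .multiset f Γs π

/-- Refutations in tree-like Resolution(f), which operates on sets. -/
def TreeLikeRes (f : ℕ → ℕ) (Γs : List Clause) (π : List Line) : Prop :=
  IsRefutation .set f Γs π ∧ IsTreeLike π

/-- The formula `⋀ᵣ Γᵣ`, a clause being the disjunction of its terms. -/
def toFormula (Γs : List Clause) : Formula :=
  .bigAnd (Γs.map fun G => .bigOr (G.map fun t => .bigAnd (t.map .lit)))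

/-! ### A machine model: programs on symbolic expressions, with running times -/

/-- Symbolic expressions. Symbols have no structure: programs can only compare them. -/
inductive SExp where
  | nil
  | sym (n : ℕ)
  | cons (x y : SExp)
  deriving DecidableEq

namespace SExp

/-- The number of nodes and leaves. -/
def size : SExp → ℕ
  | nil => 1
  | sym _ => 1
  | cons x y => x.size + y.size + 1

def car : SExp → SExp
  | cons x _ => x
  | _ => nil

def cdr : SExp → SExp
  | cons _ y => y
  | _ => nil

/-- Truth values: `nil` is false. -/
def ofBool : Bool → SExp
  | true => sym 0
  | false => nil

def isCons : SExp → Bool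
  | cons _ _ => true
  | _ => false

/-- Lists as expressions. -/
def ofList : List SExp → SExp
  | [] => nil
  | x :: l => cons x (ofList l)

end SExp

/-- Programs, each of which transforms an expression. -/
inductive Prog where
  | id
  | const (d : SExp)
  | car
  | cdr
  | isCons
  | cons (p q : Prog)
  | isEq (p q : Prog)
  | seq (p q : Prog)
  | cond (p q r : Prog)
  | loop (p q : Prog)

/-- `Prog.Run p x y t`: on input `x` the program `p` halts with output `y` after time `t`. A basic
operation costs the size of the data that it reads or writes, so the running time also bounds the
size of the output. `seq p q` runs `p`, then `q`; `loop p q` repeats `q` while `p` gives true. -/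
inductive Prog.Run : Prog → SExp → SExp → ℕ → Prop where
  | id (x) : Prog.Run .id x x x.size
  | const (d x) : Prog.Run (.const d) x d d.size
  | car (x) : Prog.Run .car x x.car x.size
  | cdr (x) : Prog.Run .cdr x x.cdr x.size
  | isCons (x) : Prog.Run .isCons x (.ofBool x.isCons) x.size
  | cons {p q x y z m n} : Prog.Run p x y m → Prog.Run q x z n →
      Prog.Run (.cons p q) x (.cons y z) (m + n + 1)
  | isEq {p q x y z m n} : Prog.Run p x y m → Prog.Run q x z n →
      Prog.Run (.isEq p q) x (.ofBool (decide (y = z))) (m + n + 1)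
  | seq {p q x y z m n} : Prog.Run p x y m → Prog.Run q y z n →
      Prog.Run (.seq p q) x z (m + n + 1)
  | condTrue {p q r x b y m n} : Prog.Run p x b m → b ≠ .nil → Prog.Run q x y n →
      Prog.Run (.cond p q r) x y (m + n + 1)
  | condFalse {p q r x y m n} : Prog.Run p x .nil m → Prog.Run r x y n →
      Prog.Run (.cond p q r) x y (m + n + 1)
  | loopDone {p q x m} : Prog.Run p x .nil m → Prog.Run (.loop p q) x x (m + x.size + 1)
  | loopStep {p q x b y z m n k} : Prog.Run p x b m → b ≠ .nil → Prog.Run q x y n →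
      Prog.Run (.loop p q) y z k → Prog.Run (.loop p q) x z (m + n + k + 1)

/-! ### Refutations and derivations as symbolic expressions -/

/-- Line numbers are written in unary. -/
def natCode (n : ℕ) : SExp := .ofList (List.replicate n .nil)

def Literal.code (a : Literal) : SExp := .cons (.sym a.var) (.sym (if a.pos then 1 else 0))

def Formula.code : Formula → SExp
  | .top => .ofList [.sym 0]
  | .bot => .ofList [.sym 1]
  | .lit a => .ofList [.sym 2, a.code]
  | .and A B => .ofList [.sym 3, A.code, B.code]
  | .or A B => .ofList [.sym 4, A.code, B.code]

def Rule.code : Rule → SExp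
  | .identity => .sym 0
  | .weakening => .sym 1
  | .contraction => .sym 2
  | .switch => .sym 3
  | .medial => .sym 4
  | .equ => .sym 5

def Deriv.code : Deriv → SExp
  | .form A => .ofList [.sym 0, A.code]
  | .and Φ Ψ => .ofList [.sym 1, Φ.code, Ψ.code]
  | .or Φ Ψ => .ofList [.sym 2, Φ.code, Ψ.code]
  | .infer ρ Φ Ψ => .ofList [.sym 3, ρ.code, Φ.code, Ψ.code]

def Clause.code (C : Clause) : SExp :=
  .ofList (C.map fun t => .ofList (t.map Literal.code))

def Justification.code : Justification → SExp
  | .hyp r => .ofList [.sym 0, natCode r]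
  | .wk i => .ofList [.sym 1, natCode i]
  | .and i j => .ofList [.sym 2, natCode i, natCode j]
  | .res i j => .ofList [.sym 3, natCode i, natCode j]

def Line.code (L : Line) : SExp := .cons L.clause.code L.just.code

/-- The clauses to be refuted, together with the refutation. -/
def refutationCode (Γs : List Clause) (π : List Line) : SExp :=
  .cons (.ofList (Γs.map Clause.code)) (.ofList (π.map Line.code))

/-! ### Polynomial simulation -/

/-- `KS` polynomially simulates the refutation system `T`, where `T Γs π` means that `π` is a
refutation of `⋀ Γs`: one program transforms, in polynomial time, every refutation of a formula
`A` in `T` into a `KS` proof of the dual of `A` (of polynomial size). -/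
def KSPolySimulates (T : List Clause → List Line → Prop) : Prop :=
  ∃ (p : Prog) (q : Polynomial ℕ), ∀ (Γs : List Clause) (π : List Line), T Γs π →
    ∃ (Φ : Deriv) (t : ℕ),
      p.Run (refutationCode Γs π) Φ.code t ∧
      t ≤ q.eval (refutationCode Γs π).size ∧
      Φ.size ≤ q.eval (refutationCode Γs π).size ∧
      Φ.IsKSProof (toFormula Γs).dual

end DeepInf

namespace DeepInf

open Polynomial

/-! ### Polynomial-time functions -/

/-! The refutation is read upside down. The last line is empty, so its dual is ⊤, and weakening
embeds ⊤ in the disjunction of the duals of all lines and all hypotheses. The lines are then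
eliminated from the last to the first: the dual of a line derives the dual of a hypothesis, or the
disjunction of the duals of its premisses; weakening embeds this in the disjunction that remains and
contraction merges the two (`translate`). In the end only the duals of the hypotheses are left. A
line used several times is merged rather than copied, so the dag structure by itself costs nothing.

Both binary rules are one inference, `cutD`. If W̄ → Ā ∨ B̄ is derivable, then two switches lead
from X̄ ∧ Ȳ ∧ W̄ to (X̄ ∧ Ā) ∨ (Ȳ ∧ B̄). For ∧-introduction W consists of s ∧ t, whose dual is s̄ ∨
t̄; for resolution W is empty and Ā ∨ B̄ is an excluded middle, obtained from atomic identities by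
distributivity (`From_resAx`).

Two duals of the resolution rules are not rules of `KS`. Weakening dualises to coweakening A ∧ B →
A. It is avoided by replacing each line by a part of it: if a premiss has lost the term on which the
rule acts, then this premiss itself serves as the conclusion. Union of sets dualises to
cocontraction A → A ∧ A, since a term common to both premisses is needed twice. For multisets this
does not arise. For sets the multiplicity n of a term is recorded in its dual, on the literals: ⋁ᵢ
āᵢⁿ. Medial splits the exponent n + m (`From.medialL`), and surplus copies of a literal are absorbed
by A ∧ A → A ∨ A → A (`From.collapse`). Multiplicities add up from premisses to conclusion; in a
tree their sum is bounded by the total length of the lines (`weight_le_of_tree`).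

A refutation does not name the terms on which its rules act. The program tries all of them and keeps
the first candidate that is contained in the given line and is not too long. Every candidate
contained in the line is sound (`From_cands`), and for a refutation a candidate passing both tests
exists (`exists_cand`, `cand_length`). The limit on the length bounds the running time on all
inputs. Polynomial time is the predicate `PT`, shown to be closed under composition, bounded
iteration and recursion on lists and formulae. -/

theorem eval_mono_nat (q : ℕ[X]) {m n : ℕ} (h : m ≤ n) : q.eval m ≤ q.eval n := by
  induction q using Polynomial.induction_on' with
  | add p q hp hq => simpa using add_le_add hp hq
  | monomial k a => simpa using Nat.mul_le_mul_left a (Nat.pow_le_pow_left h k)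

theorem SExp.one_le_size (x : SExp) : 1 ≤ x.size := by
  cases x <;> simp [SExp.size]

theorem SExp.car_size (x : SExp) : x.car.size ≤ x.size := by
  cases x <;> simp [SExp.size, SExp.car]; omega

theorem SExp.cdr_size (x : SExp) : x.cdr.size ≤ x.size := by
  cases x <;> simp [SExp.size, SExp.cdr]; omega

@[simp] theorem SExp.ofBool_size (b : Bool) : (SExp.ofBool b).size = 1 := by
  cases b <;> rfl

/-- Every operation pays for what it writes. So in a composition the time bound of the first program
is also the size bound to which the polynomial of the second is applied. -/
theorem Prog.Run.size_le {p : Prog} {x y : SExp} {t : ℕ} (h : p.Run x y t) : y.size ≤ t := by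
  induction h with
  | id => rfl
  | const => rfl
  | car x => exact x.car_size
  | cdr x => exact x.cdr_size
  | isCons x => simpa using x.one_le_size
  | cons _ _ h1 h2 => simp only [SExp.size]; omega
  | isEq _ _ h1 h2 => simp
  | seq _ _ h1 h2 => omega
  | condTrue _ _ _ h1 h2 => omega
  | condFalse _ _ h1 h2 => omega
  | loopDone _ h => omega
  | loopStep _ _ _ _ h1 h2 h3 => omega

/-- Types whose elements are written as symbolic expressions. -/
class Enc (α : Type) where
  enc : α → SExp

/-- Encodings under which equality can be tested. -/
class InjEnc (α : Type) [Enc α] : Prop where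
  inj : Function.Injective (Enc.enc : α → SExp)

/-- The size of an encoded object. -/
def sz {α : Type} [Enc α] (a : α) : ℕ := (Enc.enc a).size

/-- A function is computed by a program in polynomial time. -/
@[fun_prop]
def PT {α β : Type} [Enc α] [Enc β] (f : α → β) : Prop :=
  ∃ (p : Prog) (q : ℕ[X]), ∀ a, ∃ t, p.Run (Enc.enc a) (Enc.enc (f a)) t ∧ t ≤ q.eval (sz a)

instance : Enc SExp := ⟨fun x => x⟩
instance : Enc Unit := ⟨fun _ => .nil⟩
instance : Enc Bool := ⟨SExp.ofBool⟩
instance : Enc ℕ := ⟨natCode⟩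
instance : Enc Literal := ⟨Literal.code⟩
instance : Enc Formula := ⟨Formula.code⟩
instance : Enc Deriv := ⟨Deriv.code⟩
instance : Enc Justification := ⟨Justification.code⟩

section
variable {α β γ δ : Type} [Enc α] [Enc β] [Enc γ] [Enc δ]

instance : Enc (α × β) := ⟨fun x => .cons (Enc.enc x.1) (Enc.enc x.2)⟩
instance : Enc (List α) := ⟨fun l => .ofList (l.map Enc.enc)⟩

instance : Enc Line := ⟨Line.code⟩

theorem sz_pos (a : α) : 1 ≤ sz a := SExp.one_le_size _

@[simp] theorem sz_pair (a : α) (b : β) : sz (a, b) = sz a + sz b + 1 := rfl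
theorem sz_pair' (a : α × β) : sz a = sz a.1 + sz a.2 + 1 := rfl
@[simp] theorem sz_nil : sz ([] : List α) = 1 := rfl
@[simp] theorem sz_cons (a : α) (l : List α) : sz (a :: l) = sz a + sz l + 1 := rfl
@[simp] theorem sz_bool (b : Bool) : sz b = 1 := SExp.ofBool_size b

theorem PT.size_le {f : α → β} (h : PT f) : ∃ q : ℕ[X], ∀ a, sz (f a) ≤ q.eval (sz a) := by
  obtain ⟨p, q, h⟩ := h
  refine ⟨q, fun a => ?_⟩
  obtain ⟨t, h1, h2⟩ := h a
  exact h1.size_le.trans h2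

/-- A program computes `f` when it does so on codes, with an explicit time bound. -/
@[fun_prop]
theorem PT.id : PT (fun a : α => a) :=
  ⟨.id, X, fun a => ⟨_, .id _, by simp [sz]⟩⟩

@[fun_prop]
theorem PT.const (b : β) : PT (fun _ : α => b) :=
  ⟨.const (Enc.enc b), C (sz b), fun a => ⟨_, .const _ _, by simp [sz]⟩⟩

@[fun_prop]
theorem PT.comp {g : β → γ} {f : α → β} (hg : PT g) (hf : PT f) : PT (fun a => g (f a)) := by
  obtain ⟨p, q, hf⟩ := hf
  obtain ⟨p', q', hg⟩ := hg
  refine ⟨.seq p p', q + q'.comp q + 1, fun a => ?_⟩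
  obtain ⟨t, h1, h2⟩ := hf a
  obtain ⟨t', h1', h2'⟩ := hg (f a)
  refine ⟨_, .seq h1 h1', ?_⟩
  have := eval_mono_nat q' (h1.size_le.trans h2)
  simp only [eval_add, eval_comp, eval_one]
  unfold sz at *
  omega

@[fun_prop]
theorem PT.pair {f : α → β} {g : α → γ} (hf : PT f) (hg : PT g) :
    PT (fun a => (f a, g a)) := by
  obtain ⟨p, q, hf⟩ := hf
  obtain ⟨p', q', hg⟩ := hg
  refine ⟨.cons p p', q + q' + 1, fun a => ?_⟩
  obtain ⟨t, h1, h2⟩ := hf a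
  obtain ⟨t', h1', h2'⟩ := hg a
  refine ⟨_, .cons h1 h1', ?_⟩
  simp only [eval_add, eval_one]
  omega

theorem PT.car_of {f : α → β} (h : ∀ a, Enc.enc (f a) = (Enc.enc a).car) : PT f :=
  ⟨.car, X, fun a => ⟨_, (h a).symm ▸ Prog.Run.car (Enc.enc a), by simp [sz]⟩⟩

theorem PT.cdr_of {f : α → β} (h : ∀ a, Enc.enc (f a) = (Enc.enc a).cdr) : PT f :=
  ⟨.cdr, X, fun a => ⟨_, (h a).symm ▸ Prog.Run.cdr (Enc.enc a), by simp [sz]⟩⟩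

/-- Functions that do not change the code. -/
theorem PT.id_of {f : α → β} (h : ∀ a, Enc.enc (f a) = Enc.enc a) : PT f :=
  ⟨.id, X, fun a => ⟨sz a, by rw [h a]; exact Prog.Run.id _, by simp⟩⟩

@[fun_prop]
theorem PT.fst' : PT (fun x : α × β => x.1) := PT.car_of fun _ => rfl

@[fun_prop]
theorem PT.snd' : PT (fun x : α × β => x.2) := PT.cdr_of fun _ => rfl

@[fun_prop]
theorem PT.fst {f : α → β × γ} (hf : PT f) : PT (fun x => (f x).1) := PT.fst'.comp hf

@[fun_prop]
theorem PT.snd {f : α → β × γ} (hf : PT f) : PT (fun x => (f x).2) := PT.snd'.comp hf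

@[fun_prop]
theorem PT.cond {b : α → Bool} {f g : α → β} (hb : PT b) (hf : PT f) (hg : PT g) :
    PT (fun a => bif b a then f a else g a) := by
  obtain ⟨p0, q0, hb⟩ := hb
  obtain ⟨p, q, hf⟩ := hf
  obtain ⟨p', q', hg⟩ := hg
  refine ⟨.cond p0 p p', q0 + q + q' + 1, fun a => ?_⟩
  obtain ⟨t0, h0, h0'⟩ := hb a
  obtain ⟨t, h1, h2⟩ := hf a
  obtain ⟨t', h1', h2'⟩ := hg a
  simp only [eval_add, eval_one]
  cases hba : b a
  · rw [hba] at h0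
    exact ⟨_, .condFalse h0 h1', by omega⟩
  · rw [hba] at h0
    exact ⟨_, .condTrue h0 (by simp [Enc.enc, SExp.ofBool]) h1, by omega⟩

theorem PT.decEqSExp {f g : α → SExp} (hf : PT f) (hg : PT g) :
    PT (fun a => decide (f a = g a)) := by
  obtain ⟨p, q, hf⟩ := hf
  obtain ⟨p', q', hg⟩ := hg
  refine ⟨.isEq p p', q + q' + 1, fun a => ?_⟩
  obtain ⟨t, h1, h2⟩ := hf a
  obtain ⟨t', h1', h2'⟩ := hg a
  refine ⟨_, .isEq h1 h1', ?_⟩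
  simp only [eval_add, eval_one]
  omega

theorem PT.enc : PT (fun a : α => (Enc.enc a : SExp)) := PT.id_of fun _ => rfl

@[fun_prop]
theorem PT.decEq [DecidableEq β] [InjEnc β] {f g : α → β} (hf : PT f) (hg : PT g) :
    PT (fun a => decide (f a = g a)) := by
  have h := PT.decEqSExp (PT.enc.comp hf) (PT.enc.comp hg)
  refine (iff_of_eq (congrArg PT (funext fun a => ?_))).1 h
  exact decide_eq_decide.2 (InjEnc.inj (α := β)).eq_iff

@[fun_prop]
theorem PT.not {f : α → Bool} (hf : PT f) : PT (fun a => !f a) := by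
  refine (iff_of_eq (congrArg PT (funext fun a => ?_))).1
    (PT.cond hf (PT.const false) (PT.const true))
  cases f a <;> rfl

@[fun_prop]
theorem PT.band {f g : α → Bool} (hf : PT f) (hg : PT g) : PT (fun a => f a && g a) := by
  refine (iff_of_eq (congrArg PT (funext fun a => ?_))).1 (PT.cond hf hg (PT.const false))
  cases f a <;> rfl

@[fun_prop]
theorem PT.bor {f g : α → Bool} (hf : PT f) (hg : PT g) : PT (fun a => f a || g a) := by
  refine (iff_of_eq (congrArg PT (funext fun a => ?_))).1 (PT.cond hf (PT.const true) hg)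
  cases f a <;> rfl

/-- All intermediate states need a common polynomial bound, not just each single round: polynomial
growth could compound over the rounds. -/
theorem PT.iterate {init : β → α} {step : α → α} {test : α → Bool} {N : β → ℕ} (hi : PT init)
    (hs : PT step) (ht : PT test)
    (h1 : ∀ s, ∀ k < N s, test (step^[k] (init s)) = true)
    (h2 : ∀ s, test (step^[N s] (init s)) = false)
    (bN : ∃ q : ℕ[X], ∀ s, N s ≤ q.eval (sz s))
    (bs : ∃ q : ℕ[X], ∀ s, ∀ k ≤ N s, sz (step^[k] (init s)) ≤ q.eval (sz s)) :
    PT (fun s => step^[N s] (init s)) := by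
  obtain ⟨p0, q0, hi⟩ := hi
  obtain ⟨p, q, hs⟩ := hs
  obtain ⟨p', q', ht⟩ := ht
  obtain ⟨qN, bN⟩ := bN
  obtain ⟨qs, bs⟩ := bs
  refine ⟨.seq p0 (.loop p' p), q0 + (qN + 1) * (q.comp qs + q'.comp qs + qs + 1) + 1,
    fun s => ?_⟩
  set M := qs.eval (sz s) with hM
  -- Induction on the number `j` of remaining rounds, because `loopStep` puts a round in front.
  -- Since `M` bounds every state, all rounds have the same cost bound.
  have key : ∀ j ≤ N s, ∃ t, (Prog.loop p' p).Run (Enc.enc (step^[N s - j] (init s)))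
      (Enc.enc (step^[N s] (init s))) t ∧ t ≤ (j + 1) * (q.eval M + q'.eval M + M + 1) := by
    intro j
    induction j with
    | zero =>
      intro _
      obtain ⟨t, hr, hb⟩ := ht (step^[N s] (init s))
      rw [h2] at hr
      refine ⟨_, .loopDone hr, ?_⟩
      have e1 := eval_mono_nat q' (bs s _ le_rfl)
      have e2 := bs s _ le_rfl
      rw [← hM] at e1 e2
      change _ + sz (step^[N s] (init s)) + 1 ≤ _
      rw [zero_add, one_mul]
      omega
    | succ j ih =>
      intro hj
      obtain ⟨t, hr, hb⟩ := ih (by omega)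
      obtain ⟨t1, hr1, hb1⟩ := ht (step^[N s - (j + 1)] (init s))
      obtain ⟨t2, hr2, hb2⟩ := hs (step^[N s - (j + 1)] (init s))
      rw [h1 s _ (by omega)] at hr1
      rw [← Function.iterate_succ_apply' step, show (N s - (j + 1)).succ = N s - j by omega] at hr2
      refine ⟨_, .loopStep hr1 (by simp [Enc.enc, SExp.ofBool]) hr2 hr, ?_⟩
      have e1 := eval_mono_nat q' (bs s _ (Nat.sub_le (N s) (j + 1)))
      have e2 := eval_mono_nat q (bs s _ (Nat.sub_le (N s) (j + 1)))
      rw [← hM] at e1 e2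
      rw [add_mul (j + 1) 1, one_mul]
      omega
  obtain ⟨t, hr, hb⟩ := key (N s) le_rfl
  obtain ⟨t0, hr0, hb0⟩ := hi s
  rw [Nat.sub_self] at hr
  refine ⟨_, .seq hr0 hr, ?_⟩
  simp only [eval_mul, eval_add, eval_one, eval_comp, ← hM]
  have := Nat.mul_le_mul_right (q.eval M + q'.eval M + M + 1) (Nat.add_le_add_right (bN s) 1)
  omega

/-! ### Lists -/

theorem PT.nonempty' : PT (fun l : List α => !l.isEmpty) := by
  refine ⟨.isCons, X, fun l => ⟨(Enc.enc l).size, ?_, ?_⟩⟩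
  · convert Prog.Run.isCons (Enc.enc l) using 1
    cases l <;> rfl
  · simp [sz]

@[fun_prop]
theorem PT.isEmpty {l : α → List β} (h : PT l) : PT (fun a => (l a).isEmpty) := by
  refine (iff_of_eq (congrArg PT (funext fun a => ?_))).1 (PT.nonempty'.comp h).not
  simp

@[fun_prop]
theorem PT.cons {f : α → β} {l : α → List β} (hf : PT f) (hl : PT l) :
    PT (fun a => f a :: l a) :=
  (PT.id_of (f := fun p : β × List β => p.1 :: p.2) fun _ => rfl).comp (hf.pair hl)

@[fun_prop]
theorem PT.tail {l : α → List β} (hl : PT l) : PT (fun a => (l a).tail) :=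
  (PT.cdr_of (f := fun l : List β => l.tail) fun l => by cases l <;> rfl).comp hl

/-- The pair `(e, x :: l)` and the triple `(e, x, l)` have the same code, so the program for `g`
runs on the input as it stands. -/
theorem PT.listCases' {c : α → γ} {g : α × β × List β → γ} (hc : PT c) (hg : PT g) :
    PT (fun p : α × List β => List.casesOn (motive := fun _ => γ) p.2 (c p.1)
      (fun x l => g (p.1, x, l))) := by
  obtain ⟨p, q, hc⟩ := hc
  obtain ⟨p', q', hg⟩ := hg
  refine ⟨.cond (.seq .cdr .isCons) p' (.seq .car p), 3 * X + q + q' + 3, fun a => ?_⟩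
  obtain ⟨e, l⟩ := a
  simp only [eval_add, eval_mul, eval_X, eval_ofNat]
  have e1 : sz l ≤ sz (e, l) := by simp; omega
  have e2 : sz e ≤ sz (e, l) := by simp; omega
  cases l with
  | nil =>
    obtain ⟨t, hr, hb⟩ := hc e
    refine ⟨_, .condFalse (.seq (.cdr _) (.isCons _)) (.seq (.car _) hr), ?_⟩
    have := eval_mono_nat q e2
    change sz (e, ([] : List β)) + sz ([] : List β) + 1 + (sz (e, ([] : List β)) + t + 1) + 1 ≤ _
    omega
  | cons x l =>
    obtain ⟨t, hr, hb⟩ := hg (e, x, l)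
    refine ⟨_, .condTrue (b := .sym 0) (.seq (.cdr _) (.isCons _)) (by simp) hr, ?_⟩
    change sz (e, x :: l) + sz (x :: l) + 1 + t + 1 ≤ _
    change t ≤ q'.eval (sz (e, x :: l)) at hb
    omega

theorem PT.listCases {l : α → List β} {c : α → γ} {g : α → β → List β → γ} (hl : PT l) (hc : PT c)
    (hg : PT (fun p : α × β × List β => g p.1 p.2.1 p.2.2)) :
    PT (fun a => List.casesOn (motive := fun _ => γ) (l a) (c a) (fun x l => g a x l)) :=
  (PT.listCases' hc hg).comp (PT.id.pair hl)

theorem length_le_sz (l : List α) : l.length ≤ sz l := by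
  induction l with
  | nil => simp
  | cons a l ih => simp; omega

/-- Primitive recursion on lists. -/
def listRec (c : α → γ) (g : α → β → List β → γ → γ) (e : α) : List β → γ
  | [] => c e
  | x :: l => g e x l (listRec c g e l)

/-- Moving elements from one list to the other preserves the total size; two lists end in two
`nil`s, their concatenation in one. -/
theorem sz_reverse_append (l m : List β) : sz l + sz m = sz (l.reverse ++ m) + 1 := by
  induction l generalizing m with
  | nil => simp; omega
  | cons x l ih => have := ih (x :: m); simp at this ⊢; omega

theorem PT.reverse' : PT (fun l : List β => l.reverse) := by
  let step : List β × List β → List β × List β := fun s =>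
    List.casesOn (motive := fun _ => List β × List β) s.1 s fun x l => (l, x :: s.2)
  have hstep : PT step := by
    apply PT.listCases <;> fun_prop
  have it : ∀ l m k : List β, step^[l.length] (l ++ k, m) = (k, l.reverse ++ m) := by
    intro l
    induction l with
    | nil => intro m k; simp
    | cons x l ih => intro m k; simpa [step] using ih (x :: m) k
  have it' : ∀ (l : List β) (k : ℕ), k ≤ l.length →
      step^[k] (l, []) = (l.drop k, (l.take k).reverse) := by
    intro l k hk
    have := it (l.take k) [] (l.drop k)
    rwa [List.take_append_drop, List.length_take_of_le hk, List.append_nil] at this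
  have H : PT (fun l : List β => step^[l.length] (l, [])) := by
    refine PT.iterate (test := fun s => !s.1.isEmpty) (by fun_prop) hstep (by fun_prop) ?_ ?_ ?_ ?_
    · intro l k hk
      rw [it' l k hk.le]
      simpa using hk
    · intro l
      rw [it' l _ le_rfl]
      simp
    · exact ⟨X, fun l => by simpa using length_le_sz l⟩
    · refine ⟨X + 2, fun l k hk => ?_⟩
      rw [it' l _ hk]
      have := sz_reverse_append (l.take k).reverse (l.drop k)
      rw [List.reverse_reverse, List.take_append_drop] at this
      simp
      omega
  refine (iff_of_eq (congrArg PT (funext fun l => ?_))).1 H.snd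
  rw [it' l _ le_rfl]
  simp

@[fun_prop]
theorem PT.reverse {l : α → List β} (h : PT l) : PT (fun a => (l a).reverse) := PT.reverse'.comp h

/-- Primitive recursion on lists, where every step adds only a polynomial amount of data. -/
theorem PT.listRec' {c : α → γ} {g : α → β → List β → γ → γ} (hc : PT c)
    (hg : PT (fun p : α × β × List β × γ => g p.1 p.2.1 p.2.2.1 p.2.2.2))
    (hb : ∃ q : ℕ[X], ∀ e x l r, sz (g e x l r) ≤ sz r + q.eval (sz e + sz x + sz l)) :
    PT (fun p : α × List β => listRec c g p.1 p.2) := by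
  obtain ⟨qc, hqc⟩ := hc.size_le
  obtain ⟨qg, hqg⟩ := hb
  -- Recursion begins at the end of the list, so the loop will run over the reversed list. The third
  -- component collects the elements already treated; it is the tail that `g` receives.
  let step : α × List β × List β × γ → α × List β × List β × γ := fun s =>
    List.casesOn (motive := fun _ => α × List β × List β × γ) s.2.1 s fun x l =>
      (s.1, l, x :: s.2.2.1, g s.1 x s.2.2.1 s.2.2.2)
  have hstep : PT step := by
    apply PT.listCases (by fun_prop) (by fun_prop)
    refine PT.pair (by fun_prop) (PT.pair (by fun_prop) (PT.pair (by fun_prop) ?_))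
    exact hg.comp (f := fun p : (α × List β × List β × γ) × β × List β =>
      (p.1.1, p.2.1, p.1.2.2.1, p.1.2.2.2)) (by fun_prop)
  have it : ∀ (e : α) (l m k : List β), step^[l.length] (e, l ++ k, m, listRec c g e m) =
      (e, k, l.reverse ++ m, listRec c g e (l.reverse ++ m)) := by
    intro e l
    induction l with
    | nil => intro m k; simp
    | cons x l ih => intro m k; simpa [step, listRec] using ih (x :: m) k
  have it' : ∀ (e : α) (l : List β) (k : ℕ), k ≤ l.length → step^[k] (e, l, [], c e) =
      (e, l.drop k, (l.take k).reverse, listRec c g e (l.take k).reverse) := by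
    intro e l k hk
    have := it e (l.take k) [] (l.drop k)
    rwa [List.take_append_drop, List.length_take_of_le hk, List.append_nil] at this
  -- The increment allowed by `qg` does not involve the recursive value, so the increments add up
  -- instead of compounding.
  have hsz : ∀ (e : α) (l m : List β), sz (listRec c g e m) ≤
      qc.eval (sz e) + m.length * qg.eval (sz e + sz m) := by
    intro e l m
    induction m with
    | nil => simpa [listRec] using hqc e
    | cons x m ih =>
      have h2 := hqg e x m (listRec c g e m)
      have h3 : qg.eval (sz e + sz x + sz m) ≤ qg.eval (sz e + sz (x :: m)) :=
        eval_mono_nat _ (by simp; omega)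
      have h4 : m.length * qg.eval (sz e + sz m) ≤ m.length * qg.eval (sz e + sz (x :: m)) :=
        Nat.mul_le_mul_left _ (eval_mono_nat _ (by simp; omega))
      rw [listRec, List.length_cons, add_mul, one_mul]
      omega
  have H : PT (fun p : α × List β => step^[p.2.length] (p.1, p.2, [], c p.1)) := by
    refine PT.iterate (test := fun s => !s.2.1.isEmpty) (by fun_prop) hstep (by fun_prop) ?_ ?_ ?_ ?_
    · rintro ⟨e, l⟩ k hk
      rw [it' e l k hk.le]
      simpa using hk
    · rintro ⟨e, l⟩
      rw [it' e l _ le_rfl]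
      simp
    · refine ⟨X, fun s => ?_⟩
      have := length_le_sz s.2
      have := sz_pair' s
      simp only [eval_X]
      omega
    · refine ⟨X + 4 + (qc + X * qg), ?_⟩
      rintro ⟨e, l⟩ k hk
      rw [it' e l _ hk]
      have h1 := sz_reverse_append (l.take k).reverse (l.drop k)
      rw [List.reverse_reverse, List.take_append_drop] at h1
      have h2 := hsz e l (l.take k).reverse
      have h3 := sz_pos (l.drop k)
      have h4 : (l.take k).reverse.length * qg.eval (sz e + sz (l.take k).reverse) ≤
          sz (e, l) * qg.eval (sz (e, l)) := by
        refine Nat.mul_le_mul ?_ (eval_mono_nat _ (by simp; omega))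
        have := length_le_sz l
        simp
        omega
      have h5 : qc.eval (sz e) ≤ qc.eval (sz (e, l)) := eval_mono_nat _ (by simp; omega)
      simp only [eval_add, eval_mul, eval_X, eval_ofNat]
      simp only [sz_pair] at *
      omega
  refine (iff_of_eq (congrArg PT (funext fun p => ?_))).1
    (H.comp (f := fun p : α × List β => (p.1, p.2.reverse)) (by fun_prop)).snd.snd.snd
  rw [it' _ _ _ le_rfl]
  simp [List.take_of_length_le]

end

end DeepInf

namespace DeepInf

open Polynomial

section
variable {α β γ δ : Type} [Enc α] [Enc β] [Enc γ] [Enc δ]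

/-! ### Polynomial-time list operations -/

theorem PT.congr {f g : α → β} (hf : PT f) (h : ∀ a, f a = g a) : PT g :=
  (funext h : f = g) ▸ hf

/-- Recursion on lists, for a step that uses the recursive result in a linear way. -/
theorem PT.listRec {l : α → List β} {c : α → γ} {h : α → β → List β → δ} {k : δ → γ → γ}
    (hl : PT l) (hc : PT c) (hh : PT (fun p : α × β × List β => h p.1 p.2.1 p.2.2))
    (hk : PT (fun p : δ × γ => k p.1 p.2)) (hb : ∃ C, ∀ d r, sz (k d r) ≤ sz r + C * (sz d)) :
    PT (fun a => DeepInf.listRec c (fun e x l r => k (h e x l) r) a (l a)) := by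
  obtain ⟨qh, hqh⟩ := hh.size_le
  obtain ⟨C', hC⟩ := hb
  refine (PT.listRec' (g := fun e x l r => k (h e x l) r) hc ?_
    ⟨C C' * qh.comp (X + 2), fun e x l r => ?_⟩).comp (PT.id.pair hl)
  · exact hk.comp (f := fun p : α × β × List β × γ => (h p.1 p.2.1 p.2.2.1, p.2.2.2))
      (PT.pair (hh.comp (f := fun p : α × β × List β × γ => (p.1, p.2.1, p.2.2.1)) (by fun_prop))
        (by fun_prop))
  · refine (hC _ _).trans ?_
    have := hqh (e, x, l)
    simp only [sz_pair] at this
    simp only [eval_mul, eval_C, eval_comp, eval_add, eval_X, eval_ofNat]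
    have := Nat.mul_le_mul_left C' this
    rw [show sz e + (sz x + sz l + 1) + 1 = sz e + sz x + sz l + 2 by ring] at this
    omega

@[fun_prop]
theorem PT.map {l : α → List β} {f : α → β → γ} (hf : PT (fun p : α × β => f p.1 p.2))
    (hl : PT l) : PT (fun a => (l a).map (fun b => f a b)) := by
  refine (PT.listRec (h := fun a b _ => f a b) (k := fun d r => d :: r) hl (PT.const [])
    (hf.comp (f := fun p : α × β × List β => (p.1, p.2.1)) (by fun_prop)) (by fun_prop)
    ⟨2, fun d r => by have := sz_pos d; simp; omega⟩).congr fun a => ?_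
  induction l a with
  | nil => rfl
  | cons x l ih => simp [DeepInf.listRec, ih]

theorem PT.append_const : PT (fun p : List α × List α => p.1 ++ p.2) := by
  refine (PT.listRec (l := fun p : List α × List α => p.1) (c := fun p => p.2)
    (h := fun _ b _ => b) (k := fun d r => d :: r) (by fun_prop) (by fun_prop) (by fun_prop)
    (by fun_prop) ⟨2, fun d r => by have := sz_pos d; simp; omega⟩).congr ?_
  have : ∀ (e : List α × List α) (l : List α),
      DeepInf.listRec (fun p : List α × List α => p.2) (fun _ x _ r => x :: r) e l = l ++ e.2 := by
    intro e l
    induction l with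
    | nil => rfl
    | cons x l ih => simpa [DeepInf.listRec] using ih
  exact fun p => this p p.1

@[fun_prop]
theorem PT.append {l m : α → List β} (hl : PT l) (hm : PT m) : PT (fun a => l a ++ m a) :=
  PT.append_const.comp (hl.pair hm)

theorem sz_append (l m : List α) : sz (l ++ m) + 1 = sz l + sz m := by
  have := sz_reverse_append l.reverse m
  have h2 := sz_reverse_append l []
  simp at *
  omega

@[fun_prop]
theorem PT.flatMap {l : α → List β} {f : α → β → List γ}
    (hf : PT (fun p : α × β => f p.1 p.2)) (hl : PT l) :
    PT (fun a => (l a).flatMap (fun b => f a b)) := by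
  refine (PT.listRec (h := fun a b _ => f a b) (k := fun d r => d ++ r) hl (PT.const [])
    (hf.comp (f := fun p : α × β × List β => (p.1, p.2.1)) (by fun_prop)) (by fun_prop)
    ⟨1, fun d r => by have := sz_append d r; omega⟩).congr fun a => ?_
  induction l a with
  | nil => rfl
  | cons x l ih => simp [DeepInf.listRec, ih]

@[fun_prop]
theorem PT.filter {l : α → List β} {f : α → β → Bool}
    (hf : PT (fun p : α × β => f p.1 p.2)) (hl : PT l) :
    PT (fun a => (l a).filter (fun b => f a b)) := by
  refine (PT.flatMap (f := fun a b => bif f a b then [b] else []) (by fun_prop) hl).congr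
    fun a => ?_
  induction l a with
  | nil => rfl
  | cons x l ih => cases h : f a x <;> simp [h, ih]

@[fun_prop]
theorem PT.any {l : α → List β} {f : α → β → Bool}
    (hf : PT (fun p : α × β => f p.1 p.2)) (hl : PT l) :
    PT (fun a => (l a).any (fun b => f a b)) := by
  refine (PT.filter hf hl).isEmpty.not.congr fun a => ?_
  induction l a with
  | nil => rfl
  | cons x l ih => cases h : f a x <;> simp_all

@[fun_prop]
theorem PT.mem [DecidableEq β] [InjEnc β] {b : α → β} {l : α → List β} (hb : PT b) (hl : PT l) :
    PT (fun a => decide (b a ∈ l a)) := by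
  refine (PT.any (f := fun a x => decide (b a = x)) (by fun_prop) hl).congr fun a => ?_
  rw [Bool.eq_iff_iff]
  simp

@[fun_prop]
theorem PT.length {l : α → List β} (hl : PT l) : PT (fun a => (l a).length) := by
  refine ((PT.id_of (f := fun l : List Unit => l.length) fun l => ?_).comp
    (PT.map (f := fun _ _ => ()) (by fun_prop) hl)).congr fun a => by simp
  induction l with
  | nil => rfl
  | cons x l ih => exact congrArg (SExp.cons SExp.nil) ih

/-- Unary numbers have the codes of lists of units, which reduces recursion on numbers to recursion
on lists. -/
theorem PT.units : PT (fun n : ℕ => List.replicate n ()) :=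
  PT.id_of fun n => by simp [Enc.enc, natCode]

@[fun_prop]
theorem PT.replicate {n : α → ℕ} {b : α → β} (hn : PT n) (hb : PT b) :
    PT (fun a => List.replicate (n a) (b a)) :=
  (PT.map (f := fun a _ => b a) (by fun_prop) (PT.units.comp hn)).congr fun a => by simp

@[fun_prop]
theorem PT.drop {n : α → ℕ} {l : α → List β} (hn : PT n) (hl : PT l) :
    PT (fun a => (l a).drop (n a)) := by
  refine (PT.listRec (h := fun _ _ _ => ()) (k := fun _ r => r.tail) (PT.units.comp hn) hl
    (by fun_prop) (by fun_prop) ⟨0, fun d r => ?_⟩).congr fun a => ?_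
  · cases r <;> simp; omega
  · induction n a with
    | zero => rfl
    | succ n ih => simp [List.replicate_succ, DeepInf.listRec, ih]

@[fun_prop]
theorem PT.headD {l : α → List β} {b : α → β} (hl : PT l) (hb : PT b) :
    PT (fun a => (l a).headD (b a)) := by
  refine (PT.listCases (g := fun _ x _ => x) hl hb (by fun_prop)).congr fun a => ?_
  cases l a <;> rfl

@[fun_prop]
theorem PT.head?_toList {l : α → List β} (hl : PT l) : PT (fun a => (l a).head?.toList) := by
  refine (PT.listCases (g := fun _ x _ => [x]) hl (PT.const []) (by fun_prop)).congr fun a => ?_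
  cases l a <;> rfl

@[fun_prop]
theorem PT.getElem?_toList {l : α → List β} {n : α → ℕ} (hn : PT n) (hl : PT l) :
    PT (fun a => (l a)[n a]?.toList) := by
  have : PT (fun a => ((l a).drop (n a)).head?.toList) := by fun_prop
  exact this.congr fun a => by simp

@[fun_prop]
theorem PT.count [DecidableEq β] [InjEnc β] {b : α → β} {l : α → List β} (hb : PT b)
    (hl : PT l) : PT (fun a => (l a).count (b a)) := by
  have : PT (fun a => ((l a).filter (fun x => decide (x = b a))).length) := by fun_prop
  refine this.congr fun a => ?_
  rw [List.count, List.countP_eq_length_filter]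
  rfl

@[fun_prop]
theorem PT.erase [DecidableEq β] [InjEnc β] {b : α → β} {l : α → List β} (hb : PT b)
    (hl : PT l) : PT (fun a => (l a).erase (b a)) := by
  -- the result for the tail is either kept, or replaced by the tail itself
  have h : PT (fun p : List β × β => p.1.erase p.2) := by
    refine ((PT.listRec' (α := β) (β := β) (γ := List β) (c := fun _ => [])
      (g := fun b x l r => bif decide (x = b) then l else x :: r) (by fun_prop) (by fun_prop)
      ⟨X + 1, fun e x l r => ?_⟩).comp (f := fun p : List β × β => (p.2, p.1))
      (by fun_prop)).congr ?_
    · cases decide (x = e) <;> simp <;> omega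
    · rintro ⟨l, b⟩
      simp only
      induction l with
      | nil => rfl
      | cons x l ih =>
        by_cases hx : x = b <;> simp [DeepInf.listRec, hx, ih]
  exact h.comp (hl.pair hb)

@[fun_prop]
theorem PT.dedup [DecidableEq β] [InjEnc β] {l : α → List β} (hl : PT l) :
    PT (fun a => (l a).dedup) := by
  refine (PT.listRec (γ := List β) (h := fun _ x l => bif decide (x ∈ l) then [] else [x])
    (k := fun d r => d ++ r) hl (PT.const []) (by fun_prop) (by fun_prop)
    ⟨1, fun d r => by have := sz_append d r; omega⟩).congr fun a => ?_
  induction l a with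
  | nil => rfl
  | cons x l ih =>
    by_cases hx : x ∈ l <;> simp [DeepInf.listRec, hx, ih]

end

end DeepInf

namespace DeepInf

open Polynomial

section
variable {α β γ δ : Type} [Enc α] [Enc β] [Enc γ] [Enc δ]

/-! ### Encodings that determine the encoded object -/

instance : InjEnc SExp := ⟨fun _ _ h => h⟩

instance : InjEnc Literal := ⟨by
  rintro ⟨v, p⟩ ⟨w, q⟩ h
  cases p <;> cases q <;> simp_all [Enc.enc, Literal.code]⟩

instance [InjEnc α] : InjEnc (List α) := ⟨by
  intro l
  induction l with
  | nil => intro m h; cases m <;> simp_all [Enc.enc, SExp.ofList]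
  | cons x l ih =>
    intro m h
    cases m with
    | nil => simp [Enc.enc, SExp.ofList] at h
    | cons y m =>
      obtain ⟨h1, h2⟩ := SExp.cons.inj h
      rw [InjEnc.inj h1, ih h2]⟩

theorem Formula.code_injective : Function.Injective Formula.code := by
  intro A
  induction A with
  | top => intro B h; cases B <;> simp_all [Formula.code, SExp.ofList]
  | bot => intro B h; cases B <;> simp_all [Formula.code, SExp.ofList]
  | lit a =>
    intro B h
    cases B <;> simp_all [Formula.code, SExp.ofList]
    exact InjEnc.inj (α := Literal) h
  | and A B ihA ihB =>
    intro C h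
    cases C <;> simp [Formula.code, SExp.ofList] at h ⊢
    exact ⟨ihA h.1, ihB h.2⟩
  | or A B ihA ihB =>
    intro C h
    cases C <;> simp [Formula.code, SExp.ofList] at h ⊢
    exact ⟨ihA h.1, ihB h.2⟩

instance : InjEnc Formula := ⟨Formula.code_injective⟩

instance : DecidableEq Formula := fun _ _ =>
  decidable_of_iff _ Formula.code_injective.eq_iff

/-- `SExp` is encoded by the identity, so both statements unfold to the same one. A constructor can
therefore be treated by writing out its code. -/
theorem PT.of_enc {f : α → β} (h : PT (fun a => Enc.enc (f a))) : PT f := h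

@[fun_prop]
theorem PT.sexpCar {f : α → SExp} (hf : PT f) : PT (fun a => (f a).car) :=
  (PT.car_of (f := SExp.car) fun _ => rfl).comp hf

@[fun_prop]
theorem PT.sexpCdr {f : α → SExp} (hf : PT f) : PT (fun a => (f a).cdr) :=
  (PT.cdr_of (f := SExp.cdr) fun _ => rfl).comp hf

@[fun_prop]
theorem PT.sexpCons {f g : α → SExp} (hf : PT f) (hg : PT g) :
    PT (fun a => SExp.cons (f a) (g a)) :=
  (PT.id_of (f := fun p : SExp × SExp => SExp.cons p.1 p.2) fun _ => rfl).comp (hf.pair hg)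

@[fun_prop]
theorem PT.enc' {f : α → β} (hf : PT f) : PT (fun a => (Enc.enc (f a) : SExp)) := PT.enc.comp hf

/-! ### Formulae and derivations -/

@[fun_prop]
theorem PT.lit {f : α → Literal} (hf : PT f) : PT (fun a => Formula.lit (f a)) :=
  PT.of_enc (show PT (fun a => SExp.cons (.sym 2) (.cons (Enc.enc (f a)) .nil)) by fun_prop)

@[fun_prop]
theorem PT.formulaAnd {f g : α → Formula} (hf : PT f) (hg : PT g) :
    PT (fun a => Formula.and (f a) (g a)) :=
  PT.of_enc (show PT (fun a => SExp.cons (.sym 3) (.cons (Enc.enc (f a))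
    (.cons (Enc.enc (g a)) .nil))) by fun_prop)

@[fun_prop]
theorem PT.formulaOr {f g : α → Formula} (hf : PT f) (hg : PT g) :
    PT (fun a => Formula.or (f a) (g a)) :=
  PT.of_enc (show PT (fun a => SExp.cons (.sym 4) (.cons (Enc.enc (f a))
    (.cons (Enc.enc (g a)) .nil))) by fun_prop)

@[fun_prop]
theorem PT.derivForm {f : α → Formula} (hf : PT f) : PT (fun a => Deriv.form (f a)) :=
  PT.of_enc (show PT (fun a => SExp.cons (.sym 0) (.cons (Enc.enc (f a)) .nil)) by fun_prop)

@[fun_prop]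
theorem PT.derivAnd {f g : α → Deriv} (hf : PT f) (hg : PT g) :
    PT (fun a => Deriv.and (f a) (g a)) :=
  PT.of_enc (show PT (fun a => SExp.cons (.sym 1) (.cons (Enc.enc (f a))
    (.cons (Enc.enc (g a)) .nil))) by fun_prop)

@[fun_prop]
theorem PT.derivOr {f g : α → Deriv} (hf : PT f) (hg : PT g) :
    PT (fun a => Deriv.or (f a) (g a)) :=
  PT.of_enc (show PT (fun a => SExp.cons (.sym 2) (.cons (Enc.enc (f a))
    (.cons (Enc.enc (g a)) .nil))) by fun_prop)

@[fun_prop]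
theorem PT.derivInfer {ρ : Rule} {f g : α → Deriv} (hf : PT f) (hg : PT g) :
    PT (fun a => Deriv.infer ρ (f a) (g a)) :=
  PT.of_enc (show PT (fun a => SExp.cons (.sym 3) (.cons ρ.code (.cons (Enc.enc (f a))
    (.cons (Enc.enc (g a)) .nil)))) by fun_prop)

theorem sz_formulaAnd (A B : Formula) : sz (Formula.and A B) = sz A + sz B + 5 := by
  simp [sz, Enc.enc, Formula.code, SExp.ofList, SExp.size]; omega
theorem sz_formulaOr (A B : Formula) : sz (Formula.or A B) = sz A + sz B + 5 := by
  simp [sz, Enc.enc, Formula.code, SExp.ofList, SExp.size]; omega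
theorem sz_derivForm (A : Formula) : sz (Deriv.form A) = sz A + 4 := by
  simp [sz, Enc.enc, Deriv.code, SExp.ofList, SExp.size]; omega
theorem sz_derivAnd (Φ Ψ : Deriv) : sz (Deriv.and Φ Ψ) = sz Φ + sz Ψ + 5 := by
  simp [sz, Enc.enc, Deriv.code, SExp.ofList, SExp.size]; omega
theorem sz_derivOr (Φ Ψ : Deriv) : sz (Deriv.or Φ Ψ) = sz Φ + sz Ψ + 5 := by
  simp [sz, Enc.enc, Deriv.code, SExp.ofList, SExp.size]; omega
theorem sz_derivInfer (ρ : Rule) (Φ Ψ : Deriv) :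
    sz (Deriv.infer ρ Φ Ψ) = sz Φ + sz Ψ + 7 := by
  cases ρ <;> simp [sz, Enc.enc, Deriv.code, Rule.code, SExp.ofList, SExp.size] <;> omega

@[fun_prop]
theorem PT.dual {f : α → Literal} (hf : PT f) : PT (fun a => (f a).dual) := by
  refine PT.comp (f := f) (g := Literal.dual) ?_ hf
  have : PT (fun a : Literal => SExp.cons (Enc.enc a : SExp).car
    (bif decide ((Enc.enc a : SExp).cdr = .sym 1) then .sym 0 else .sym 1)) := by fun_prop
  refine PT.of_enc (this.congr ?_)
  rintro ⟨v, p⟩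
  cases p <;> simp [Enc.enc, Literal.code, SExp.cdr, SExp.car, Literal.dual]

/-! ### Polynomial-time recursion on formulae -/

def Formula.isNode : Formula → Bool
  | .and _ _ => true
  | .or _ _ => true
  | _ => false

def Formula.isAnd : Formula → Bool
  | .and _ _ => true
  | _ => false

def Formula.left : Formula → Formula
  | .and A _ => A
  | .or A _ => A
  | A => A

def Formula.right : Formula → Formula
  | .and _ B => B
  | .or _ B => B
  | A => A

@[fun_prop]
theorem PT.isNode : PT Formula.isNode := by
  have : PT (fun A : Formula => decide ((Enc.enc A : SExp).car = .sym 3) ||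
    decide ((Enc.enc A : SExp).car = .sym 4)) := by fun_prop
  refine this.congr fun A => ?_
  cases A <;> simp [Enc.enc, Formula.code, SExp.ofList, SExp.car, Formula.isNode]

@[fun_prop]
theorem PT.isAnd : PT Formula.isAnd := by
  have : PT (fun A : Formula => decide ((Enc.enc A : SExp).car = .sym 3)) := by fun_prop
  refine this.congr fun A => ?_
  cases A <;> simp [Enc.enc, Formula.code, SExp.ofList, SExp.car, Formula.isAnd]

@[fun_prop]
theorem PT.left : PT Formula.left := by
  have : PT (fun A : Formula => bif A.isNode then (Enc.enc A : SExp).cdr.car else Enc.enc A) := by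
    fun_prop
  refine PT.of_enc (this.congr fun A => ?_)
  cases A <;> simp [Enc.enc, Formula.code, SExp.ofList, SExp.car, SExp.cdr, Formula.isNode,
    Formula.left]

@[fun_prop]
theorem PT.right : PT Formula.right := by
  have : PT (fun A : Formula => bif A.isNode then (Enc.enc A : SExp).cdr.cdr.car
    else Enc.enc A) := by fun_prop
  refine PT.of_enc (this.congr fun A => ?_)
  cases A <;> simp [Enc.enc, Formula.code, SExp.ofList, SExp.car, SExp.cdr, Formula.isNode,
    Formula.right]

/-- Recursion on formulae. -/
def formulaRec (lf : Formula → β) (nd : Formula → β → β → β) : Formula → β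
  | .and A B => nd (.and A B) (formulaRec lf nd A) (formulaRec lf nd B)
  | .or A B => nd (.or A B) (formulaRec lf nd A) (formulaRec lf nd B)
  | A => lf A

/-- The number of steps of a machine that evaluates a formula recursion with a stack. -/
def Formula.steps : Formula → ℕ
  | .and A B => A.steps + B.steps + 2
  | .or A B => A.steps + B.steps + 2
  | _ => 1

theorem Formula.steps_le (A : Formula) : A.steps ≤ sz A := by
  induction A with
  | and A B ihA ihB => simp only [Formula.steps, sz_formulaAnd]; omega
  | or A B ihA ihB => simp only [Formula.steps, sz_formulaOr]; omega
  | _ => exact sz_pos _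

/-- The machine can only loop, so recursion on trees needs an explicit stack. The values of the two
parts enter the size bound of a node additively; this keeps the growth per step bounded. -/
theorem PT.formulaRec' {lf : Formula → β} {nd : Formula → β → β → β} (hl : PT lf)
    (hn : PT (fun p : Formula × β × β => nd p.1 p.2.1 p.2.2))
    (hb : ∃ q : ℕ[X], ∀ A x y, sz (nd A x y) ≤ sz x + sz y + q.eval (sz A)) :
    PT (formulaRec lf nd) := by
  obtain ⟨ql, hql⟩ := hl.size_le
  obtain ⟨qn, hqn⟩ := hb
  -- the work list holds formulae to be evaluated and nodes whose parts have been evaluated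
  let nodeStep : List (Bool × Formula) → Formula → List β → List (Bool × Formula) × List β := fun I A st =>
    List.casesOn (motive := fun _ => List (Bool × Formula) × List β) st (I, []) fun y st' =>
      List.casesOn (motive := fun _ => List (Bool × Formula) × List β) st' (I, []) fun x st'' => (I, nd A x y :: st'')
  let step : List (Bool × Formula) × List β → List (Bool × Formula) × List β := fun s =>
    List.casesOn (motive := fun _ => List (Bool × Formula) × List β) s.1 s fun i I =>
      bif i.1 then nodeStep I i.2 s.2
      else bif i.2.isNode then ((false, i.2.left) :: (false, i.2.right) :: (true, i.2) :: I, s.2)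
      else (I, lf i.2 :: s.2)
  have hnode : PT (fun p : List (Bool × Formula) × Formula × List β =>
      nodeStep p.1 p.2.1 p.2.2) := by
    apply PT.listCases (by fun_prop) (by fun_prop)
    apply PT.listCases (by fun_prop) (by fun_prop)
    refine PT.pair (by fun_prop) (PT.cons ?_ (by fun_prop))
    exact hn.comp (f := fun p : ((List (Bool × Formula) × Formula × List β) × β × List β) ×
      β × List β => (p.1.1.2.1, p.2.1, p.1.2.1)) (by fun_prop)
  have hstep : PT step := by
    apply PT.listCases (by fun_prop) (by fun_prop)
    refine PT.cond (by fun_prop) ?_ (by fun_prop)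
    exact hnode.comp (f := fun p : (List (Bool × Formula) × List β) × (Bool × Formula) × List (Bool × Formula) =>
      (p.2.2, p.2.1.2, p.1.2)) (by fun_prop)
  have stepF : ∀ A I st, step ((false, A) :: I, st) = bif A.isNode then
      ((false, A.left) :: (false, A.right) :: (true, A) :: I, st) else (I, lf A :: st) :=
    fun _ _ _ => rfl
  have it : ∀ (A : Formula) (I : List (Bool × Formula)) (st : List β),
      step^[A.steps] ((false, A) :: I, st) = (I, formulaRec lf nd A :: st) := by
    intro A
    induction A with
    | and A B ihA ihB =>
      intro I st
      rw [Formula.steps, show A.steps + B.steps + 2 = (1 + B.steps) + A.steps + 1 by ring,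
        Function.iterate_succ_apply, Function.iterate_add_apply, Function.iterate_add_apply]
      simp only [stepF, Formula.isNode, cond_true, Formula.left, Formula.right]
      rw [ihA, ihB]
      rfl
    | or A B ihA ihB =>
      intro I st
      rw [Formula.steps, show A.steps + B.steps + 2 = (1 + B.steps) + A.steps + 1 by ring,
        Function.iterate_succ_apply, Function.iterate_add_apply, Function.iterate_add_apply]
      simp only [stepF, Formula.isNode, cond_true, Formula.left, Formula.right]
      rw [ihA, ihB]
      rfl
    | _ => intro I st; rfl
  -- before its end the work list is not empty
  have pos : ∀ (A : Formula) (I : List (Bool × Formula)) (st : List β), ∀ k < A.steps,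
      (step^[k] ((false, A) :: I, st)).1 ≠ [] := by
    intro A
    have aux : ∀ A B C : Formula, C.steps = A.steps + B.steps + 2 → C.isNode = true →
        C.left = A → C.right = B →
        (∀ (I : List (Bool × Formula)) (st : List β), ∀ k < A.steps,
          (step^[k] ((false, A) :: I, st)).1 ≠ []) →
        (∀ (I : List (Bool × Formula)) (st : List β), ∀ k < B.steps,
          (step^[k] ((false, B) :: I, st)).1 ≠ []) →
        ∀ (I : List (Bool × Formula)) (st : List β), ∀ k < C.steps,
          (step^[k] ((false, C) :: I, st)).1 ≠ [] := by
      intro A B C h1 h2 h3 h4 ihA ihB I st k hk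
      cases k with
      | zero => simp
      | succ k =>
        rw [Function.iterate_succ_apply]
        simp only [stepF, h2, h3, h4, cond_true]
        by_cases hkA : k < A.steps
        · exact ihA _ _ k hkA
        · obtain ⟨j, rfl⟩ := Nat.exists_eq_add_of_le' (not_lt.1 hkA)
          rw [Function.iterate_add_apply, it]
          by_cases hkB : j < B.steps
          · exact ihB _ _ j hkB
          · obtain ⟨i, rfl⟩ := Nat.exists_eq_add_of_le' (not_lt.1 hkB)
            rw [Function.iterate_add_apply, it]
            have : i = 0 := by omega
            subst this
            simp
    induction A with
    | and A B ihA ihB => exact aux A B _ rfl rfl rfl rfl ihA ihB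
    | or A B ihA ihB => exact aux A B _ rfl rfl rfl rfl ihA ihB
    | _ =>
      intro I st k hk
      have : k = 0 := by simpa [Formula.steps] using hk
      subst this
      simp
  -- All formulae on the work list have size at most `n`, hence a step adds at most a fixed amount:
  -- when a node is completed, the two values removed from the stack account for all but `qn` and a
  -- constant.
  have bound : ∀ (n k : ℕ) (s : List (Bool × Formula) × List β), (∀ i ∈ s.1, sz i.2 ≤ n) →
      (∀ i ∈ (step^[k] s).1, sz i.2 ≤ n) ∧
      sz (step^[k] s) ≤ sz s + k * (3 * n + ql.eval n + qn.eval n + 10) := by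
    intro n k
    induction k with
    | zero => intro s hs; simpa using hs
    | succ k ih =>
      intro s hs
      have key : (∀ i ∈ (step s).1, sz i.2 ≤ n) ∧
          sz (step s) ≤ sz s + (3 * n + ql.eval n + qn.eval n + 10) := by
        obtain ⟨I, st⟩ := s
        cases I with
        | nil => exact ⟨hs, Nat.le_add_right _ _⟩
        | cons i I =>
          obtain ⟨b, A⟩ := i
          simp only [List.mem_cons, forall_eq_or_imp] at hs
          obtain ⟨hA, hI⟩ := hs
          have e1 := eval_mono_nat ql hA
          have e2 := eval_mono_nat qn hA
          have e3 := hql A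
          cases b with
          | true =>
            rcases st with _ | ⟨y, _ | ⟨x, st⟩⟩
            · refine ⟨hI, ?_⟩
              simp only [step, nodeStep, cond_true, sz_pair, sz_cons]
              omega
            · refine ⟨hI, ?_⟩
              simp only [step, nodeStep, cond_true, sz_pair, sz_cons, sz_nil]
              omega
            · refine ⟨hI, ?_⟩
              have := hqn A x y
              simp only [step, nodeStep, cond_true, sz_pair, sz_cons]
              omega
          | false =>
            by_cases hN : A.isNode
            · have hl : sz A.left ≤ sz A := by
                cases A <;> simp [Formula.left, sz_formulaAnd, sz_formulaOr] <;> omega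
              have hr : sz A.right ≤ sz A := by
                cases A <;> simp [Formula.right, sz_formulaAnd, sz_formulaOr] <;> omega
              constructor
              · simp only [step, hN, cond_true, cond_false, List.mem_cons, forall_eq_or_imp]
                exact ⟨hl.trans hA, hr.trans hA, hA, hI⟩
              · simp only [step, hN, cond_true, cond_false, sz_pair, sz_cons, sz_bool]
                omega
            · simp only [step, Bool.not_eq_true _ ▸ hN, cond_false, sz_pair, sz_cons, sz_bool]
              exact ⟨hI, by omega⟩
      rw [Function.iterate_succ_apply]
      obtain ⟨h1, h2⟩ := ih (step s) key.1
      refine ⟨h1, ?_⟩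
      rw [add_mul k, one_mul]
      omega
  have H : PT (fun A : Formula => step^[A.steps] ([(false, A)], [])) := by
    refine PT.iterate (init := fun A : Formula => (([(false, A)], []) : List (Bool × Formula) × List β))
      (test := fun s => !s.1.isEmpty) (by fun_prop) hstep (by fun_prop) ?_ ?_
      ⟨X, fun A => by simpa using A.steps_le⟩
      ⟨X + 6 + X * (3 * X + ql + qn + 10), fun A k hk => ?_⟩
    · intro A k hk
      have := pos A [] [] k hk
      simpa using this
    · intro A
      rw [it]
      rfl
    · refine ((bound (sz A) k ([(false, A)], []) (by simp)).2).trans ?_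
      have := Nat.mul_le_mul_right (3 * sz A + ql.eval (sz A) + qn.eval (sz A) + 10)
        (hk.trans A.steps_le)
      simp only [sz_pair, sz_cons, sz_nil, sz_bool, eval_add, eval_mul, eval_X, eval_ofNat]
      omega
  have H2 : PT (fun A : Formula => (step^[A.steps] ([(false, A)], [])).2.headD (lf A)) := by
    fun_prop
  exact H2.congr fun A => by rw [it]; rfl

end

end DeepInf

namespace DeepInf

/-! ### Formulae up to equality -/

namespace Formula

instance equalSetoid : Setoid Formula := ⟨Equal, ⟨.refl, .symm, .trans⟩⟩

/-- Formulae modulo the logical rule; `∨` is written as a sum and `∧` as a product. -/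
abbrev Quo := Quotient equalSetoid

def q (A : Formula) : Quo := Quotient.mk _ A

theorem q_eq {A B : Formula} : A.q = B.q ↔ Equal A B := Quotient.eq

theorem Equal.orCongr₂ {A A' B B' : Formula} (h : Equal A A') (h' : Equal B B') :
    Equal (or A B) (or A' B') :=
  (Equal.orCongr A h').trans ((Equal.orComm _ _).trans ((Equal.orCongr B' h).trans (.orComm _ _)))

theorem Equal.andCongr₂ {A A' B B' : Formula} (h : Equal A A') (h' : Equal B B') :
    Equal (and A B) (and A' B') :=
  (Equal.andCongr A h').trans
    ((Equal.andComm _ _).trans ((Equal.andCongr B' h).trans (.andComm _ _)))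

instance : Add Quo := ⟨Quotient.map₂ or fun _ _ h _ _ h' => h.orCongr₂ h'⟩
instance : Mul Quo := ⟨Quotient.map₂ and fun _ _ h _ _ h' => h.andCongr₂ h'⟩
instance : Zero Quo := ⟨bot.q⟩
instance : One Quo := ⟨top.q⟩

@[simp] theorem q_or (A B : Formula) : (or A B).q = A.q + B.q := rfl
@[simp] theorem q_and (A B : Formula) : (and A B).q = A.q * B.q := rfl
@[simp] theorem q_bot : bot.q = 0 := rfl
@[simp] theorem q_top : top.q = 1 := rfl

theorem Quo.add_comm' (a b : Quo) : a + b = b + a :=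
  Quotient.inductionOn₂ a b fun A B => q_eq.2 (.orComm A B)

theorem Quo.mul_comm' (a b : Quo) : a * b = b * a :=
  Quotient.inductionOn₂ a b fun A B => q_eq.2 (.andComm A B)

theorem Quo.add_zero' (a : Quo) : a + 0 = a := Quotient.inductionOn a fun A => q_eq.2 (.orBot A)

theorem Quo.mul_one' (a : Quo) : a * 1 = a := Quotient.inductionOn a fun A => q_eq.2 (.andTop A)

/-- The two monoid structures are not linked by a distributive law; the only mixed equations are `1
+ 1 = 1` and `0 * 0 = 0`. -/
instance : AddCommMonoid Quo where
  add_assoc a b c := Quotient.inductionOn₃ a b c fun A B C => q_eq.2 (.orAssoc A B C)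
  zero_add a := (Quo.add_comm' _ _).trans (Quo.add_zero' a)
  add_zero := Quo.add_zero'
  add_comm := Quo.add_comm'
  nsmul := nsmulRec

instance : CommMonoid Quo where
  mul_assoc a b c := Quotient.inductionOn₃ a b c fun A B C => q_eq.2 (.andAssoc A B C)
  one_mul a := (Quo.mul_comm' _ _).trans (Quo.mul_one' a)
  mul_one := Quo.mul_one'
  mul_comm := Quo.mul_comm'

@[simp] theorem Quo.one_add_one : (1 : Quo) + 1 = 1 := q_eq.2 .topTop
@[simp] theorem Quo.zero_mul_zero : (0 : Quo) * 0 = 0 := q_eq.2 .botBot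

theorem Quo.zero_pow {n : ℕ} (h : n ≠ 0) : (0 : Quo) ^ n = 0 := by
  obtain ⟨n, rfl⟩ := Nat.exists_eq_succ_of_ne_zero h
  induction n with
  | zero => simp
  | succ n ih => rw [pow_succ, ih (by simp)]; simp

/-- Disjunction and conjunction of lists, ending with the unit. -/
def orL (l : List Formula) : Formula := l.foldr or bot
def andL (l : List Formula) : Formula := l.foldr and top

@[simp] theorem q_orL (l : List Formula) : (orL l).q = (l.map q).sum := by
  induction l with
  | nil => rfl
  | cons A l ih => simpa [orL] using congrArg (A.q + ·) ih

@[simp] theorem q_andL (l : List Formula) : (andL l).q = (l.map q).prod := by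
  induction l with
  | nil => rfl
  | cons A l ih => simpa [andL] using congrArg (A.q * ·) ih

theorem q_bigOr (l : List Formula) : (bigOr l).q = (l.map q).sum := by
  induction l with
  | nil => rfl
  | cons A l ih => cases l <;> simp_all [bigOr]

theorem q_bigAnd (l : List Formula) : (bigAnd l).q = (l.map q).prod := by
  induction l with
  | nil => rfl
  | cons A l ih => cases l <;> simp_all [bigAnd]

theorem dual_bigAnd (l : List Formula) : (bigAnd l).dual = bigOr (l.map dual) := by
  induction l with
  | nil => rfl
  | cons A l ih => cases l <;> simp_all [bigAnd, bigOr, dual]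

theorem dual_bigOr (l : List Formula) : (bigOr l).dual = bigAnd (l.map dual) := by
  induction l with
  | nil => rfl
  | cons A l ih => cases l <;> simp_all [bigAnd, bigOr, dual]

/-- Powers with respect to conjunction. -/
def powF (A : Formula) (n : ℕ) : Formula := andL (List.replicate n A)

@[simp] theorem q_powF (A : Formula) (n : ℕ) : (powF A n).q = A.q ^ n := by
  simp [powF]

end Formula

open Formula

/-! ### Derivations up to equality of premiss and conclusion -/

/-- `Φ` is a `KS` derivation whose premiss and conclusion are `a` and `b` up to equality. -/
structure Deriv.From (Φ : Deriv) (a b : Quo) : Prop where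
  ks : Φ.IsKS
  pr : Φ.pr.q = a
  cn : Φ.cn.q = b

namespace Deriv

theorem From.form (A : Formula) : (form A).From A.q A.q := ⟨trivial, rfl, rfl⟩

theorem From.and {Φ Ψ : Deriv} {a b c d : Quo} (h : Φ.From a b) (h' : Ψ.From c d) :
    (Deriv.and Φ Ψ).From (a * c) (b * d) :=
  ⟨⟨h.ks, h'.ks⟩, by simp [Deriv.pr, h.pr, h'.pr], by simp [Deriv.cn, h.cn, h'.cn]⟩

theorem From.or {Φ Ψ : Deriv} {a b c d : Quo} (h : Φ.From a b) (h' : Ψ.From c d) :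
    (Deriv.or Φ Ψ).From (a + c) (b + d) :=
  ⟨⟨h.ks, h'.ks⟩, by simp [Deriv.pr, h.pr, h'.pr], by simp [Deriv.cn, h.cn, h'.cn]⟩

theorem From.trans {Φ Ψ : Deriv} {a b c : Quo} (h : Φ.From a b) (h' : Ψ.From b c) :
    (infer .equ Φ Ψ).From a c :=
  ⟨⟨h.ks, h'.ks, .equ (q_eq.1 (h.cn.trans h'.pr.symm))⟩, h.pr, h'.cn⟩

theorem From.congr {Φ : Deriv} {a b a' b' : Quo} (h : Φ.From a b) (ha : a = a') (hb : b = b') :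
    Φ.From a' b' := ha ▸ hb ▸ h

theorem From.rule {ρ : Rule} {A B : Formula} (h : ρ.Inst A B) :
    (infer ρ (.form A) (.form B)).From A.q B.q := ⟨⟨trivial, trivial, h⟩, rfl, rfl⟩

def switchD (A B C : Formula) : Deriv :=
  infer .switch (form (A.and (B.or C))) (form ((A.and B).or C))

theorem From.switchD (A B C : Formula) :
    (switchD A B C).From (A.q * (B.q + C.q)) (A.q * B.q + C.q) := .rule (.switch A B C)

def medialD (A B C D : Formula) : Deriv :=
  infer .medial (form ((A.and B).or (C.and D))) (form ((A.or C).and (B.or D)))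

theorem From.medialD (A B C D : Formula) :
    (medialD A B C D).From (A.q * B.q + C.q * D.q) ((A.q + C.q) * (B.q + D.q)) :=
  .rule (.medial A B C D)

/-- By the unit equations the premiss (⊥ ∧ ⊤) ∨ (⊤ ∧ ⊥) of this medial equals ⊥, and its conclusion
(⊥ ∨ ⊤) ∧ (⊤ ∨ ⊥) equals ⊤. -/
def botTop : Deriv := medialD .bot .top .top .bot

theorem From.botTop : botTop.From 0 1 :=
  (From.medialD .bot .top .top .bot).congr (by simp) (by simp)

/-- Weakening by an arbitrary formula. -/
def weak : Formula → Deriv :=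
  formulaRec (fun A => bif decide (A = .top) then botTop else bif decide (A = .bot) then form .bot
    else infer .weakening (form .bot) (form A)) fun A Φ Ψ => bif A.isAnd then and Φ Ψ else or Φ Ψ

/-- The equations ⊥ = ⊥ ∧ ⊥ and ⊥ = ⊥ ∨ ⊥ bring ⊥ to all leaves, where literals are weakened and ⊤
is produced by `botTop`. -/
theorem From.weak (A : Formula) : (weak A).From 0 A.q := by
  induction A with
  | top => exact .botTop
  | bot => exact .form _
  | lit a => exact .rule (.weakening a)
  | and A B ihA ihB => exact (ihA.and ihB).congr (by simp) rfl
  | or A B ihA ihB => exact (ihA.or ihB).congr (by simp) rfl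

/-- Contraction of an arbitrary formula. -/
def contr : Formula → Deriv :=
  formulaRec (fun A => bif decide (A = .top) then form .top else bif decide (A = .bot) then form .bot
    else infer .contraction (form (A.or A)) (form A)) fun A Φ Ψ =>
      bif A.isAnd then infer .equ (medialD A.left A.right A.left A.right) (and Φ Ψ) else or Φ Ψ

/-- Medial reduces the contraction of a conjunction to its parts; for a disjunction regrouping is
enough. -/
theorem From.contr (A : Formula) : (contr A).From (A.q + A.q) A.q := by
  induction A with
  | top => exact (From.form _).congr (by simp) rfl
  | bot => exact (From.form _).congr (by simp) rfl
  | lit a => exact .rule (.contraction a)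
  | and A B ihA ihB => exact (From.medialD A B A B).trans (ihA.and ihB)
  | or A B ihA ihB => exact (ihA.or ihB).congr (add_add_add_comm _ _ _ _) rfl

/-- `A ∧ B → A ∨ B`. -/
def mixD (A B : Formula) : Deriv :=
  infer .equ (switchD A .bot B) (or (and (form A) botTop) (form B))

/-- Switch in the form A ∧ (⊥ ∨ B) → (A ∧ ⊥) ∨ B, after which ⊥ is turned into ⊤. -/
theorem From.mixD (A B : Formula) : (mixD A B).From (A.q * B.q) (A.q + B.q) :=
  ((From.switchD A .bot B).trans (((From.form A).and .botTop).or (.form B))).congr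
    (by simp) (by simp)

/-- `(A ∨ B) ∧ (A ∨ C) → A ∨ (B ∧ C)`. -/
def distD (A B C : Formula) : Deriv :=
  infer .equ (switchD (A.or B) C A)
    (infer .equ (or (switchD C B A) (form A)) (or (form (C.and B)) (contr A)))

/-- Two switches give (A ∨ B) ∧ (C ∨ A) → ((A ∨ B) ∧ C) ∨ A → ((C ∧ B) ∨ A) ∨ A, and the two copies
of A are contracted. -/
theorem From.distD (A B C : Formula) :
    (distD A B C).From ((A.q + B.q) * (A.q + C.q)) (A.q + B.q * C.q) := by
  have h1 := From.switchD (A.or B) C A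
  have h2 := (From.switchD C B A).or (.form A)
  have h3 := (From.form (C.and B)).or (.contr A)
  have h4 := h2.trans (h3.congr (add_assoc _ _ _).symm rfl)
  refine (h1.trans (h4.congr ?_ rfl)).congr ?_ ?_ <;>
    simp [add_comm, mul_comm]

/-- From proofs of `A ∨ Bᵢ`, a proof of `A ∨ ⋀ᵢ Bᵢ`. -/
def prodD (A : Formula) : List (Formula × Deriv) → Deriv
  | [] => or (weak A) (form .top)
  | p :: l => infer .equ (and p.2 (prodD A l)) (distD A p.1 (andL (l.map Prod.fst)))

theorem From.prodD (A : Formula) (l : List (Formula × Deriv))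
    (h : ∀ p ∈ l, p.2.From 1 (A.q + p.1.q)) :
    (prodD A l).From 1 (A.q + (l.map fun p => p.1.q).prod) := by
  induction l with
  | nil => exact ((From.weak A).or (.form .top)).congr (by simp) (by simp)
  | cons p l ih =>
    have h1 := (h p (by simp)).and (ih fun p hp => h p (by simp [hp]))
    have h2 := From.distD A p.1 (andL (l.map Prod.fst))
    rw [q_andL, List.map_map] at h2
    exact (h1.trans h2).congr (by simp) (by simp [Function.comp_def])

/-- A disjunction derived from one of its members. -/
def embed (B : Formula) (l : List Formula) : Deriv := or (form B) (weak (orL (l.erase B)))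

theorem From.embed {B : Formula} {l : List Formula} (h : B ∈ l) :
    (embed B l).From B.q (orL l).q := by
  refine ((From.form B).or (.weak _)).congr (by simp) ?_
  have := ((List.perm_cons_erase h).map q).sum_eq
  simp only [q_orL, this, List.map_cons, List.sum_cons]

def idD (a : Literal) : Deriv := infer .identity (form .top) (form (.or (.lit a) (.lit a.dual)))

theorem From.idD (a : Literal) : (idD a).From 1 ((lit a).q + (lit a.dual).q) :=
  .rule (.identity a)

theorem _root_.DeepInf.Literal.dual_dual (a : Literal) : a.dual.dual = a := by
  simp [Literal.dual]

/-- `⊤ → ā ∨ aⁿ`. -/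
def idPow (a : Literal) (n : ℕ) : Deriv :=
  prodD (lit a.dual) (List.replicate n (lit a, idD a.dual))

theorem From.idPow (a : Literal) (n : ℕ) :
    (idPow a n).From 1 ((lit a.dual).q + (lit a).q ^ n) := by
  refine (From.prodD (lit a.dual) (List.replicate n (lit a, Deriv.idD a.dual)) fun p hp => ?_).congr
    rfl (by simp)
  obtain rfl := List.eq_of_mem_replicate hp
  have := From.idD a.dual
  rwa [Literal.dual_dual] at this

/-- `Aⁿ⁺¹ → A`. -/
def collapse (A : Formula) : ℕ → Deriv
  | 0 => form A
  | n + 1 => infer .equ (and (form A) (collapse A n)) (infer .equ (mixD A A) (contr A))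

/-- A surplus copy cannot be dropped by coweakening, but it can be absorbed by another copy: A ∧ A →
A ∨ A → A. -/
theorem From.collapse (A : Formula) (n : ℕ) : (collapse A n).From (A.q ^ (n + 1)) A.q := by
  induction n with
  | zero => exact (From.form A).congr (by simp) rfl
  | succ n ih =>
    exact (((From.form A).and ih).trans ((From.mixD A A).trans (.contr A))).congr
      (pow_succ' _ _).symm rfl

/-- `Aᵏ → Aⁿ` for `1 ≤ n ≤ k`. -/
def dropD (A : Formula) (k n : ℕ) : Deriv := and (form (powF A (n - 1))) (collapse A (k - n))

/-- Of the `k` copies, `n - 1` are kept and the other `k - n + 1` collapse to one. For `n = 0` there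
would be no copy left to absorb the rest. -/
theorem From.dropD (A : Formula) {k n : ℕ} (h1 : 1 ≤ n) (h2 : n ≤ k) :
    (dropD A k n).From (A.q ^ k) (A.q ^ n) := by
  refine ((From.form (powF A (n - 1))).and (.collapse A (k - n))).congr ?_ ?_
  · rw [q_powF, ← pow_add]; congr 1; omega
  · rw [q_powF, ← pow_succ]; congr 1; omega

def orD (l : List Deriv) : Deriv := l.foldr or (form .bot)
def andD (l : List Deriv) : Deriv := l.foldr and (form .top)

theorem From.orD {ι : Type*} {l : List ι} {f : ι → Deriv} {a b : ι → Quo}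
    (h : ∀ i ∈ l, (f i).From (a i) (b i)) :
    (orD (l.map f)).From (l.map a).sum (l.map b).sum := by
  induction l with
  | nil => exact .form _
  | cons i l ih => exact (h i (by simp)).or (ih fun j hj => h j (by simp [hj]))

theorem From.andD {ι : Type*} {l : List ι} {f : ι → Deriv} {a b : ι → Quo}
    (h : ∀ i ∈ l, (f i).From (a i) (b i)) :
    (andD (l.map f)).From (l.map a).prod (l.map b).prod := by
  induction l with
  | nil => exact .form _
  | cons i l ih => exact (h i (by simp)).and (ih fun j hj => h j (by simp [hj]))

/-- `⋁ᵢ (Aᵢ ∧ Bᵢ) → (⋁ᵢ Aᵢ) ∧ (⋁ᵢ Bᵢ)`. -/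
def medialL : List (Formula × Formula) → Deriv
  | [] => form .bot
  | p :: l => infer .equ (or (form (p.1.and p.2)) (medialL l))
      (medialD p.1 p.2 (orL (l.map Prod.fst)) (orL (l.map Prod.snd)))

/-- The members are merged one at a time; the empty case is ⊥ = ⊥ ∧ ⊥. Applied to powers of
literals, this does the work of cocontraction. -/
theorem From.medialL (l : List (Formula × Formula)) :
    (medialL l).From (l.map fun p => p.1.q * p.2.q).sum
      ((l.map fun p => p.1.q).sum * (l.map fun p => p.2.q).sum) := by
  induction l with
  | nil => exact (From.form .bot).congr (by simp) (by simp)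
  | cons p l ih =>
    have := From.medialD p.1 p.2 (orL (l.map Prod.fst)) (orL (l.map Prod.snd))
    simp only [q_orL, List.map_map] at this
    exact ((From.form (p.1.and p.2)).or ih).trans this

/-- `A ∧ (B ∧ (C ∨ D)) → (A ∧ C) ∨ (B ∧ D)`. -/
def crossD (A B C D : Formula) : Deriv :=
  infer .equ (and (form A) (switchD B D C)) (switchD A C (B.and D))

theorem From.crossD (A B C D : Formula) :
    (crossD A B C D).From (A.q * (B.q * (C.q + D.q))) (A.q * C.q + B.q * D.q) := by
  refine (((From.form A).and (.switchD B D C)).trans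
    ((From.switchD A C (B.and D)).congr ?_ rfl)).congr ?_ rfl
  · simp [add_comm]
  · simp [add_comm]

end Deriv

end DeepInf

namespace DeepInf

open Formula Deriv

instance : BEq TermList := instBEqOfDecidableEq

/-! ### The formulae that stand for dual terms and clauses -/

/-- The disjuncts of the dual of a term. -/
def negs (t : TermList) : List Formula := .bot :: t.map fun a => .lit a.dual

/-- The dual of a term with multiplicity `n`: in the setting of sets the literals carry the
multiplicity. -/
def termF : Setting → ℕ → TermList → Formula
  | .set, n, t => orL ((negs t).map fun A => powF A n)
  | .multiset, n, t => powF (orL (negs t)) n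

/-- The dual of the clause `X`, for terms that occur in `D`. -/
def clauseF (S : Setting) (D X : Clause) : Formula := andL (D.map fun u => termF S (X.count u) u)

/-- This is why `negs` contains ⊥: for the empty term, ⊥⁰ = ⊤ keeps the disjunction from being ⊥,
and for positive exponents ⊥ⁿ = ⊥ does no harm. Terms of `D` that are absent from a clause thus
contribute ⊤ to `clauseF`. -/
theorem termF_zero (S : Setting) (u : TermList) : (termF S 0 u).q = 1 := by
  cases S with
  | multiset => simp [termF]
  | set =>
    simp only [termF, negs, q_orL, List.map_cons, List.map_map, List.sum_cons, q_powF, pow_zero,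
      Function.comp_def]
    induction u with
    | nil => simp
    | cons a u ih => simpa [← add_assoc] using ih

theorem termF_one (S : Setting) (u : TermList) :
    (termF S 1 u).q = (u.map fun a => (lit a.dual).q).sum := by
  cases S <;> simp [termF, negs, Function.comp_def]

/-- When multiplicities are handled alike in both settings. -/
def Setting.Linear (S : Setting) (n : ℕ) : Prop := S = .multiset → n = 1

theorem termF_pos {S : Setting} {n : ℕ} (h : S.Linear n) (hn : n ≠ 0) (u : TermList) :
    (termF S n u).q = (u.map fun a => (lit a.dual).q ^ n).sum := by
  cases S with
  | multiset => rw [h rfl, termF_one]; simp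
  | set => simp [termF, negs, Quo.zero_pow hn, Function.comp_def]

/-- With one literal, the power of the disjunction and the disjunction of powers agree. So the
one-literal terms removed by resolution may have any multiplicity in both settings. -/
theorem termF_singleton (S : Setting) (n : ℕ) (a : Literal) :
    (termF S n [a]).q = (lit a.dual).q ^ n := by
  rcases Nat.eq_zero_or_pos n with rfl | hn
  · rw [termF_zero, pow_zero]
  · cases S with
    | multiset => simp [termF, negs]
    | set => simp [termF, negs, Quo.zero_pow hn.ne']

/-- For sets the exponents stand inside a disjunction, where the law of powers is not available; the
general case is an inference, `From_splitTerm`. -/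
theorem termF_add {S : Setting} {n m : ℕ} (h : S = .multiset ∨ n = 0 ∨ m = 0) (u : TermList) :
    (termF S (n + m) u).q = (termF S n u).q * (termF S m u).q := by
  rcases h with rfl | rfl | rfl
  · simp [termF, pow_add]
  · simp [termF_zero]
  · simp [termF_zero]

theorem q_clauseF (S : Setting) (D X : Clause) :
    (clauseF S D X).q = (D.map fun u => (termF S (X.count u) u).q).prod := by
  simp [clauseF, Function.comp_def]

theorem clauseF_congr (S : Setting) (D : Clause) {X Y : Clause} (h : X.Perm Y) :
    (clauseF S D X).q = (clauseF S D Y).q := by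
  simp only [q_clauseF, h.count_eq]

theorem clauseF_append {S : Setting} (D : Clause) {X Y : Clause}
    (h : S = .multiset ∨ ∀ u ∈ X, u ∉ Y) :
    (clauseF S D (X ++ Y)).q = (clauseF S D X).q * (clauseF S D Y).q := by
  simp only [q_clauseF, ← List.prod_map_mul]
  congr 1
  refine List.map_congr_left fun u _ => ?_
  rw [List.count_append]
  refine termF_add (h.imp_right fun h => ?_) u
  by_cases hu : u ∈ X
  · exact .inr (List.count_eq_zero.2 (h u hu))
  · exact .inl (List.count_eq_zero.2 hu)

theorem clauseF_nil (S : Setting) (D : Clause) : (clauseF S D []).q = 1 := by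
  simp [q_clauseF, termF_zero]

theorem prod_map_pow_count {D X : Clause} (hD : D.Nodup) (hX : X ⊆ D) (φ : TermList → Quo) :
    (D.map fun u => φ u ^ X.count u).prod = (X.map φ).prod := by
  rw [Finset.prod_list_map_count X (M := Quo) φ, ← List.prod_toFinset (M := Quo) _ hD]
  symm
  apply Finset.prod_subset
  · intro u hu
    simpa using hX (by simpa using hu)
  · intro u _ hu
    rw [List.count_eq_zero.2 (by simpa using hu), pow_zero]

theorem clauseF_replicate {S : Setting} {D : Clause} (hD : D.Nodup) {u : TermList} (hu : u ∈ D)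
    (k : ℕ) : (clauseF S D (List.replicate k u)).q = (termF S k u).q := by
  rw [q_clauseF, ← List.prod_toFinset _ hD, Finset.prod_eq_single u]
  · simp
  · intro v _ hv
    rw [List.count_eq_zero.2 (fun h => hv (List.eq_of_mem_replicate h)), termF_zero]
  · simp [hu]

theorem clauseF_singletons {S : Setting} {D X : Clause} (hD : D.Nodup) (hX : X ⊆ D)
    {φ : TermList → Quo} (h : ∀ u ∈ X, ∃ a, u = [a] ∧ φ u = (lit a.dual).q) :
    (clauseF S D X).q = (X.map φ).prod := by
  rw [← prod_map_pow_count hD hX, q_clauseF]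
  congr 1
  refine List.map_congr_left fun u _ => ?_
  by_cases hu : u ∈ X
  · obtain ⟨a, rfl, ha⟩ := h u hu
    rw [ha, termF_singleton]
  · rw [List.count_eq_zero.2 hu, termF_zero, pow_zero]

/-- In a multiset a repeated term is a repeated factor, and in a set without repetitions no exponent
exceeds 1. This identifies the formula for a hypothesis with its plain dual. -/
theorem clauseF_nodup {S : Setting} {D X : Clause} (hD : D.Nodup) (hX : X ⊆ D)
    (h : S = .multiset ∨ X.Nodup) :
    (clauseF S D X).q = (X.map fun u => (u.map fun a => (lit a.dual).q).sum).prod := by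
  rw [← prod_map_pow_count hD hX, q_clauseF]
  congr 1
  refine List.map_congr_left fun u _ => ?_
  rcases h with rfl | h
  · simp [termF, negs, Function.comp_def]
  · have := List.nodup_iff_count_le_one.1 h u
    interval_cases X.count u
    · simp [termF_zero]
    · simp [termF_one]

/-! ### Derivations between dual clauses -/

/-- Separating the copies of a term is an equality for multisets, whereas for sets it takes medials.
-/
def splitTerm : Setting → ℕ → ℕ → TermList → Deriv
  | .set, n, m, u => medialL ((negs u).map fun A => (powF A n, powF A m))
  | .multiset, n, m, u => form (termF .multiset (n + m) u)

theorem From_splitTerm (S : Setting) (n m : ℕ) (u : TermList) :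
    (splitTerm S n m u).From (termF S (n + m) u).q ((termF S n u).q * (termF S m u).q) := by
  cases S with
  | multiset => exact (From.form _).congr rfl (termF_add (.inl rfl) u)
  | set =>
    refine (From.medialL _).congr ?_ ?_ <;>
      simp [termF, pow_add, Function.comp_def]

/-- Separation of a dual clause. -/
def splitD (S : Setting) (D X Y : Clause) : Deriv :=
  andD (D.map fun u => splitTerm S (X.count u) (Y.count u) u)

theorem From_splitD (S : Setting) (D X Y : Clause) :
    (splitD S D X Y).From (clauseF S D (X ++ Y)).q
      ((clauseF S D X).q * (clauseF S D Y).q) := by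
  refine (From.andD fun u _ => From_splitTerm S (X.count u) (Y.count u) u).congr ?_ ?_
  · simp [q_clauseF]
  · rw [List.prod_map_mul, q_clauseF, q_clauseF]

/-- The dual of the conjunction of the terms `s` and `t` proves their duals, with multiplicities. -/
def andAx (k n m : ℕ) (s t : TermList) : Deriv :=
  or (orD (s.map fun a => dropD (lit a.dual) k n)) (orD (t.map fun a => dropD (lit a.dual) k m))

/-- By `Linear` the multiplicities may be read on the literals in both settings. Each literal power
is then lowered separately, to `n` in the part of `s` and to `m` in that of `t`. -/
theorem From_andAx {S : Setting} {k n m : ℕ} (hS : S.Linear k) (hn : 1 ≤ n) (hm : 1 ≤ m)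
    (hnk : n ≤ k) (hmk : m ≤ k) {s t u : TermList} (hu : u.Perm (s ++ t)) :
    (andAx k n m s t).From (termF S k u).q ((termF S n s).q + (termF S m t).q) := by
  have hSn : S.Linear n := fun h => by have := hS h; omega
  have hSm : S.Linear m := fun h => by have := hS h; omega
  refine ((From.orD fun a _ => From.dropD (lit a.dual) hn hnk).or
    (From.orD fun a _ => From.dropD (lit a.dual) hm hmk)).congr ?_ ?_
  · rw [termF_pos hS (by omega), (hu.map _).sum_eq, List.map_append, List.sum_append]
  · rw [termF_pos hSn (by omega), termF_pos hSm (by omega)]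

/-- Excluded middle for the term `s` and the conjunction of the duals of the one-literal terms
`E`. -/
def resAx (S : Setting) (n : ℕ) (s : TermList) (E : Clause) : Deriv :=
  prodD (termF S n s) (E.map fun e => (orL (negs e),
    -- The default of `headD` only makes the definition total; the terms in question have exactly
    -- one literal.
    infer .equ (idPow (e.headD ⟨0, true⟩) n)
      (or (form (orL (negs e))) (embed (powF (lit (e.headD ⟨0, true⟩)) n)
        ((negs s).map fun A => powF A n)))))

/-- For a removed term [ā] there is a proof of a ∨ āⁿ, and āⁿ is a disjunct of the dual of `s`, so
weakening turns it into a proof of a ∨ s̄. These proofs are combined by distributivity. Nothing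
requires `E` to contain the duals of all literals of `s`, or to contain them only once. -/
theorem From_resAx {S : Setting} {n : ℕ} (hS : S.Linear n) (hn : n ≠ 0) {D E : Clause}
    {s : TermList} (hD : D.Nodup) (hE : E ⊆ D) (hs : ∀ e ∈ E, ∃ a ∈ s, e = [a.dual]) :
    (resAx S n s E).From 1 ((termF S n s).q + (clauseF S D E).q) := by
  refine (From.prodD _ _ fun p hp => ?_).congr rfl ?_
  · obtain ⟨e, he, rfl⟩ := List.mem_map.1 hp
    obtain ⟨a, ha, rfl⟩ := hs e he
    have h1 := From.idPow a.dual n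
    rw [Literal.dual_dual] at h1
    have h2 : (embed (powF (lit a.dual) n) ((negs s).map fun A => powF A n)).From
        ((lit a.dual).q ^ n) (termF S n s).q := by
      refine (From.embed ?_).congr (by simp) ?_
      · exact List.mem_map.2 ⟨lit a.dual, by simp [negs]; exact ⟨a, ha, rfl⟩, rfl⟩
      · rw [termF_pos hS hn]
        simp [negs, Quo.zero_pow hn, Function.comp_def]
    refine h1.trans (((From.form (orL (negs [a.dual]))).or h2).congr ?_ ?_)
    · simp [negs, Literal.dual_dual]
    · exact add_comm _ _
  · rw [clauseF_singletons hD hE (φ := fun e => (orL (negs e)).q)]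
    · simp [Function.comp_def]
    · intro e he
      obtain ⟨a, ha, rfl⟩ := hs e he
      exact ⟨_, rfl, by simp [negs]⟩

/-- From `W̄ → Ā ∨ B̄` infer the dual of `X, Y, W` to the disjunction of the duals of `X, A` and
`Y, B`. -/
def cutD (S : Setting) (D X Y W A B : Clause) (Φ : Deriv) : Deriv :=
  infer .equ (infer .equ (splitD S D X (Y ++ W)) (and (form (clauseF S D X)) (splitD S D Y W)))
    (infer .equ (and (form (clauseF S D X)) (and (form (clauseF S D Y)) Φ))
      (crossD (clauseF S D X) (clauseF S D Y) (clauseF S D A) (clauseF S D B)))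

/-- The clause is separated, `Φ` is applied to the last part, and two switches follow. The
disjointness conditions allow the products to be read as duals of `X ++ A` and `Y ++ B`, with every
exponent coming from one side only. -/
theorem From_cutD {S : Setting} {D X Y W A B : Clause} {Φ : Deriv}
    (h : Φ.From (clauseF S D W).q ((clauseF S D A).q + (clauseF S D B).q))
    (hA : S = .multiset ∨ ∀ u ∈ X, u ∉ A) (hB : S = .multiset ∨ ∀ u ∈ Y, u ∉ B) :
    (cutD S D X Y W A B Φ).From (clauseF S D (X ++ (Y ++ W))).q
      ((clauseF S D (X ++ A)).q + (clauseF S D (Y ++ B)).q) := by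
  rw [clauseF_append D hA, clauseF_append D hB]
  exact ((From_splitD S D X (Y ++ W)).trans ((From.form _).and (From_splitD S D Y W))).trans
    (((From.form _).and ((From.form _).and h)).trans (From.crossD _ _ _ _))

end DeepInf

namespace DeepInf

open Formula Deriv

/-! ### The translation -/

/-- Terms in a normal form: the literals are listed in the order in which they occur in `V`. -/
def canon (V t : List Literal) : TermList := V.flatMap fun a => List.replicate (t.count a) a

/-- What remains of a clause when terms are removed: of a multiset, one occurrence for each; of a
set, all occurrences. -/
def rest : Setting → Clause → Clause → Clause
  | .multiset, X, Y => Y.foldr (fun y Z => Z.erase y) X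
  | .set, X, Y => X.filter fun u => !decide (u ∈ Y)

/-- What is removed of a clause by `rest`. -/
def taken (S : Setting) (X Y : Clause) : Clause := rest .multiset X (rest S X Y)

/-- The data that the translation of a line refers to: the literals, the terms, a bound for the
length of clauses, and the hypotheses together with their duals. -/
abbrev Env := List Literal × Clause × ℕ × List (Clause × Formula)

/-- The disjuncts that are left when lines with the clauses `xs` remain to be dealt with. -/
def disj (S : Setting) (e : Env) (xs : List Clause) : List Formula :=
  xs.map (fun X => clauseF S e.2.1 X) ++ e.2.2.2.map fun h => h.2

/-- The conclusion is the premiss itself. This handles weakening, and the binary rules when a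
premiss has lost the term on which the rule acts. -/
def oneCand (S : Setting) (e : Env) (xs : List Clause) (P : Clause) : Clause × Deriv :=
  (P, embed (clauseF S e.2.1 P) (disj S e xs))

/-- From the premisses `P` and `Q`, from which the terms `T` and `U` are removed, infer the clause
that contains what remains and `W`. -/
def cutCand (S : Setting) (e : Env) (xs : List Clause) (P Q T U W : Clause) (Φ : Deriv) :
    Clause × Deriv :=
  (rest S P T ++ (rest S Q U ++ W),
    infer .equ (cutD S e.2.1 (rest S P T) (rest S Q U) W (taken S P T) (taken S Q U) Φ)
      (infer .equ (or (embed (clauseF S e.2.1 P) (disj S e xs))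
        (embed (clauseF S e.2.1 Q) (disj S e xs))) (contr (orL (disj S e xs)))))

/-- The maximum of the lengths of two lists. -/
def maxLength (A B : Clause) : ℕ := (A ++ B.drop A.length).length

/-- The new term gets the larger of the two multiplicities: each disjunct of its dual serves only
one premiss. -/
def andCand (S : Setting) (e : Env) (xs : List Clause) (P Q : Clause) (s t : TermList) :
    Clause × Deriv :=
  cutCand S e xs P Q [s] [t]
    (List.replicate (maxLength (taken S P [s]) (taken S Q [t])) (canon e.1 (s ++ t)))
    (andAx (maxLength (taken S P [s]) (taken S Q [t])) (taken S P [s]).length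
      (taken S Q [t]).length s t)

def duals (s : TermList) : Clause := s.map fun a => [a.dual]

def resCand (S : Setting) (e : Env) (xs : List Clause) (P Q : Clause) (s : TermList) :
    Clause × Deriv :=
  cutCand S e xs P Q [s] (duals s) []
    (resAx S (taken S P [s]).length s (taken S Q (duals s)))

/-- The candidates for the clause of a line after weakenings have been removed, each with a
derivation from its dual; `xs` lists the previous clauses, the last one first. -/
def cands (S : Setting) (e : Env) (xs : List Clause) : Justification → List (Clause × Deriv)
  | .hyp r => e.2.2.2[r]?.toList.map fun h => (h.1, embed h.2 (disj S e xs))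
  | .wk i => xs.reverse[i]?.toList.map fun P => oneCand S e xs P
  | .and i j => xs.reverse[i]?.toList.flatMap fun P => xs.reverse[j]?.toList.flatMap fun Q =>
      oneCand S e xs P :: oneCand S e xs Q ::
        P.flatMap fun s => Q.map fun t => andCand S e xs P Q s t
  | .res i j => xs.reverse[i]?.toList.flatMap fun P => xs.reverse[j]?.toList.flatMap fun Q =>
      oneCand S e xs P :: oneCand S e xs Q :: P.map fun s => resCand S e xs P Q s

/-- The test for candidates. -/
def fits (S : Setting) (e : Env) (C X : Clause) : Bool :=
  (rest S X C).isEmpty && (X.drop e.2.2.1).isEmpty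

/-- The default makes the program total on inputs that are not refutations; `choose_of_exists`
excludes it in the correctness proof. -/
def choose (S : Setting) (e : Env) (xs : List Clause) (x : Clause × Justification) :
    Clause × Deriv :=
  ((cands S e xs x.2).filter fun c => fits S e x.1 c.1).headD ([], form .bot)

/-- The clauses of the lines after weakenings have been removed, the last one first. -/
def states (S : Setting) (e : Env) : List (Clause × Justification) → List Clause
  | [] => []
  | x :: l => (choose S e (states S e l) x).1 :: states S e l

/-- The derivation that deals with the given lines, the last one first. -/
def translate (S : Setting) (e : Env) : List (Clause × Justification) → Deriv
  | [] => form (orL (disj S e []))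
  | x :: l => infer .equ
      (or (choose S e (states S e l) x).2 (form (orL (disj S e (states S e l)))))
      (infer .equ (contr (orL (disj S e (states S e l)))) (translate S e l))

def literals (Γs : List Clause) (π : List Line) : List Literal :=
  ((Γs ++ π.map fun L => L.clause).flatMap fun C => C.flatMap fun t => t).dedup

def canonLines (V : List Literal) (π : List Line) : List (Clause × Justification) :=
  π.map fun L => (L.clause.map fun t => canon V t, L.just)

def canonHyps (V : List Literal) (Γs : List Clause) : List (Clause × Formula) :=
  Γs.map fun G => (G.map fun t => canon V t, andL (G.map fun t => orL (negs t)))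

/-- The third component, the total number of terms in all lines, is the limit for the length of
clauses counted with multiplicities. -/
def env (Γs : List Clause) (π : List Line) : Env :=
  (literals Γs π,
    (((canonHyps (literals Γs π) Γs).flatMap fun h => h.1) ++
      (canonLines (literals Γs π) π).flatMap fun x => x.1).dedup,
    ((canonLines (literals Γs π) π).flatMap fun x => x.1).length,
    canonHyps (literals Γs π) Γs)

/-- The dual of `toFormula Γs`. -/
def target (Γs : List Clause) : Formula :=
  bigOr (Γs.map fun G => bigAnd (G.map fun t => bigOr (t.map fun a => .lit a.dual)))

/-- The `KS` proof that is obtained from a refutation. -/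
def simulate (S : Setting) (r : List Clause × List Line) : Deriv :=
  -- The outer equality steps make premiss and conclusion literally correct; `Deriv.From` controls
  -- them only up to equality.
  infer .equ (form .top) (infer .equ (infer .equ
    (embed (clauseF S (env r.1 r.2).2.1 [])
      (disj S (env r.1 r.2) (states S (env r.1 r.2)
        (canonLines (literals r.1 r.2) r.2).reverse)))
    (translate S (env r.1 r.2) (canonLines (literals r.1 r.2) r.2).reverse))
    (form (target r.1)))

/-! ### The translation takes polynomial time -/

open Polynomial

section
variable {α β : Type} [Enc α] [Enc β]

@[fun_prop]
theorem PT.weak {f : α → Formula} (hf : PT f) : PT (fun a => Deriv.weak (f a)) := by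
  refine PT.comp (g := Deriv.weak) (PT.formulaRec' (by fun_prop) ?_ ⟨5, fun A x y => ?_⟩) hf
  · have h : PT Formula.isAnd := PT.isAnd
    fun_prop
  · cases A.isAnd
    · simp [sz_derivOr]
    · simp [sz_derivAnd]

@[fun_prop]
theorem PT.isAnd' {f : α → Formula} (hf : PT f) : PT (fun a => (f a).isAnd) := PT.isAnd.comp hf
@[fun_prop]
theorem PT.left' {f : α → Formula} (hf : PT f) : PT (fun a => (f a).left) := PT.left.comp hf
@[fun_prop]
theorem PT.right' {f : α → Formula} (hf : PT f) : PT (fun a => (f a).right) := PT.right.comp hf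

@[fun_prop]
theorem PT.switchD {f g h : α → Formula} (hf : PT f) (hg : PT g) (hh : PT h) :
    PT (fun a => Deriv.switchD (f a) (g a) (h a)) := by
  unfold Deriv.switchD; fun_prop

@[fun_prop]
theorem PT.medialD {f g h k : α → Formula} (hf : PT f) (hg : PT g) (hh : PT h) (hk : PT k) :
    PT (fun a => Deriv.medialD (f a) (g a) (h a) (k a)) := by
  unfold Deriv.medialD; fun_prop

@[fun_prop]
theorem PT.contr {f : α → Formula} (hf : PT f) : PT (fun a => Deriv.contr (f a)) := by
  have hm : PT (fun A : Formula => Deriv.medialD A.left A.right A.left A.right) := by fun_prop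
  obtain ⟨q, hq⟩ := hm.size_le
  refine PT.comp (g := Deriv.contr) (PT.formulaRec' (by fun_prop) (by fun_prop)
    ⟨q + 12, fun A x y => ?_⟩) hf
  have := hq A
  cases A.isAnd with
  | false => simp [sz_derivOr]
  | true =>
    simp [sz_derivAnd, sz_derivInfer]
    omega

@[fun_prop]
theorem PT.orL {f : α → List Formula} (hf : PT f) : PT (fun a => Formula.orL (f a)) := by
  refine (PT.listRec (h := fun _ A _ => A) (k := fun A r => Formula.or A r) hf
    (PT.const .bot) (by fun_prop) (by fun_prop)
    ⟨6, fun d r => by have := sz_pos d; rw [sz_formulaOr]; omega⟩).congr fun a => ?_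
  induction f a with
  | nil => rfl
  | cons x l ih => simp [DeepInf.listRec, ih, Formula.orL]

@[fun_prop]
theorem PT.andL {f : α → List Formula} (hf : PT f) : PT (fun a => Formula.andL (f a)) := by
  refine (PT.listRec (h := fun _ A _ => A) (k := fun A r => Formula.and A r) hf
    (PT.const .top) (by fun_prop) (by fun_prop)
    ⟨6, fun d r => by have := sz_pos d; rw [sz_formulaAnd]; omega⟩).congr fun a => ?_
  induction f a with
  | nil => rfl
  | cons x l ih => simp [DeepInf.listRec, ih, Formula.andL]

@[fun_prop]
theorem PT.orD {f : α → List Deriv} (hf : PT f) : PT (fun a => Deriv.orD (f a)) := by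
  refine (PT.listRec (h := fun _ A _ => A) (k := fun A r => Deriv.or A r) hf
    (PT.const (form .bot)) (by fun_prop) (by fun_prop)
    ⟨6, fun d r => by have := sz_pos d; rw [sz_derivOr]; omega⟩).congr fun a => ?_
  induction f a with
  | nil => rfl
  | cons x l ih => simp [DeepInf.listRec, ih, Deriv.orD]

@[fun_prop]
theorem PT.andD {f : α → List Deriv} (hf : PT f) : PT (fun a => Deriv.andD (f a)) := by
  refine (PT.listRec (h := fun _ A _ => A) (k := fun A r => Deriv.and A r) hf
    (PT.const (form .top)) (by fun_prop) (by fun_prop)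
    ⟨6, fun d r => by have := sz_pos d; rw [sz_derivAnd]; omega⟩).congr fun a => ?_
  induction f a with
  | nil => rfl
  | cons x l ih => simp [DeepInf.listRec, ih, Deriv.andD]

@[fun_prop]
theorem PT.bigOr {f : α → List Formula} (hf : PT f) : PT (fun a => Formula.bigOr (f a)) := by
  -- As `bigOr` does not end with a unit, each step must know whether it treats the last member.
  refine (PT.listRec (h := fun _ A l => (l.isEmpty, A))
    (k := fun d r => bif d.1 then d.2 else Formula.or d.2 r) hf
    (PT.const .bot) (by fun_prop) (by fun_prop) ⟨6, fun d r => ?_⟩).congr fun a => ?_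
  · have := sz_pos d.2
    have := sz_pair' d
    cases d.1 <;> simp [sz_formulaOr] <;> omega
  · induction f a with
    | nil => rfl
    | cons x l ih => cases l <;> simp_all [DeepInf.listRec, Formula.bigOr]

@[fun_prop]
theorem PT.bigAnd {f : α → List Formula} (hf : PT f) : PT (fun a => Formula.bigAnd (f a)) := by
  refine (PT.listRec (h := fun _ A l => (l.isEmpty, A))
    (k := fun d r => bif d.1 then d.2 else Formula.and d.2 r) hf
    (PT.const .top) (by fun_prop) (by fun_prop) ⟨6, fun d r => ?_⟩).congr fun a => ?_
  · have := sz_pos d.2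
    have := sz_pair' d
    cases d.1 <;> simp [sz_formulaAnd] <;> omega
  · induction f a with
    | nil => rfl
    | cons x l ih => cases l <;> simp_all [DeepInf.listRec, Formula.bigAnd]

@[fun_prop]
theorem PT.powF {f : α → Formula} {n : α → ℕ} (hf : PT f) (hn : PT n) :
    PT (fun a => Formula.powF (f a) (n a)) := by
  unfold Formula.powF; fun_prop

@[fun_prop]
theorem PT.mixD {f g : α → Formula} (hf : PT f) (hg : PT g) :
    PT (fun a => Deriv.mixD (f a) (g a)) := by
  unfold Deriv.mixD; fun_prop

@[fun_prop]
theorem PT.distD {f g h : α → Formula} (hf : PT f) (hg : PT g) (hh : PT h) :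
    PT (fun a => Deriv.distD (f a) (g a) (h a)) := by
  unfold Deriv.distD; fun_prop

@[fun_prop]
theorem PT.prodD {f : α → Formula} {l : α → List (Formula × Deriv)} (hf : PT f) (hl : PT l) :
    PT (fun a => Deriv.prodD (f a) (l a)) := by
  refine (PT.listRec
    (h := fun a p m => (p.2, Deriv.distD (f a) p.1 (Formula.andL (m.map fun p => p.1))))
    (k := fun d r => infer .equ (Deriv.and d.1 r) d.2) (c := fun a => or (Deriv.weak (f a))
      (form .top)) hl (by fun_prop) (by fun_prop) (by fun_prop)
    ⟨13, fun d r => ?_⟩).congr fun a => ?_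
  · have := sz_pair' d
    rw [sz_derivInfer, sz_derivAnd]; omega
  · induction l a with
    | nil => rfl
    | cons x l ih => simp [DeepInf.listRec, ih, Deriv.prodD]

@[fun_prop]
theorem PT.embed {f : α → Formula} {l : α → List Formula} (hf : PT f) (hl : PT l) :
    PT (fun a => Deriv.embed (f a) (l a)) := by
  unfold Deriv.embed; fun_prop

@[fun_prop]
theorem PT.idPow {f : α → Literal} {n : α → ℕ} (hf : PT f) (hn : PT n) :
    PT (fun a => Deriv.idPow (f a) (n a)) := by
  unfold Deriv.idPow Deriv.idD; fun_prop

@[fun_prop]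
theorem PT.tsub {n m : α → ℕ} (hn : PT n) (hm : PT m) : PT (fun a => n a - m a) := by
  have : PT (fun a => ((List.replicate (n a) ()).drop (m a)).length) := by fun_prop
  exact this.congr fun a => by simp

@[fun_prop]
theorem PT.collapse {f : α → Formula} {n : α → ℕ} (hf : PT f) (hn : PT n) :
    PT (fun a => Deriv.collapse (f a) (n a)) := by
  refine (PT.listRec (l := fun a => List.replicate (n a) ())
    (h := fun a _ _ => (f a, infer .equ (Deriv.mixD (f a) (f a)) (Deriv.contr (f a))))
    (k := fun d r => infer .equ (Deriv.and (form d.1) r) d.2) (c := fun a => form (f a))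
    (by fun_prop) (by fun_prop) (by fun_prop) (by fun_prop) ⟨17, fun d r => ?_⟩).congr fun a => ?_
  · have := sz_pair' d
    rw [sz_derivInfer, sz_derivAnd, sz_derivForm]; omega
  · induction n a with
    | zero => rfl
    | succ n ih => simp [List.replicate_succ, DeepInf.listRec, ih, Deriv.collapse]

@[fun_prop]
theorem PT.dropD {f : α → Formula} {k n : α → ℕ} (hf : PT f) (hk : PT k) (hn : PT n) :
    PT (fun a => Deriv.dropD (f a) (k a) (n a)) := by
  unfold Deriv.dropD; fun_prop

@[fun_prop]
theorem PT.medialL {l : α → List (Formula × Formula)} (hl : PT l) :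
    PT (fun a => Deriv.medialL (l a)) := by
  refine (PT.listRec (h := fun _ p m => (form (p.1.and p.2), Deriv.medialD p.1 p.2
      (Formula.orL (m.map fun p => p.1)) (Formula.orL (m.map fun p => p.2))))
    (k := fun d r => infer .equ (Deriv.or d.1 r) d.2) (c := fun a => form .bot) hl
    (by fun_prop) (by fun_prop) (by fun_prop) ⟨13, fun d r => ?_⟩).congr fun a => ?_
  · have := sz_pair' d
    rw [sz_derivInfer, sz_derivOr]; omega
  · induction l a with
    | nil => rfl
    | cons x l ih => simp [DeepInf.listRec, ih, Deriv.medialL]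

@[fun_prop]
theorem PT.crossD {f g h k : α → Formula} (hf : PT f) (hg : PT g) (hh : PT h) (hk : PT k) :
    PT (fun a => Deriv.crossD (f a) (g a) (h a) (k a)) := by
  unfold Deriv.crossD; fun_prop

@[fun_prop]
theorem PT.negs {t : α → TermList} (ht : PT t) : PT (fun a => DeepInf.negs (t a)) := by
  unfold DeepInf.negs; fun_prop

@[fun_prop]
theorem PT.termF {S : Setting} {n : α → ℕ} {t : α → TermList} (hn : PT n) (ht : PT t) :
    PT (fun a => DeepInf.termF S (n a) (t a)) := by
  cases S <;> (unfold DeepInf.termF; fun_prop)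

@[fun_prop]
theorem PT.clauseF {S : Setting} {D X : α → Clause} (hD : PT D) (hX : PT X) :
    PT (fun a => DeepInf.clauseF S (D a) (X a)) := by
  unfold DeepInf.clauseF; fun_prop

@[fun_prop]
theorem PT.splitD {S : Setting} {D X Y : α → Clause} (hD : PT D) (hX : PT X) (hY : PT Y) :
    PT (fun a => DeepInf.splitD S (D a) (X a) (Y a)) := by
  cases S with
  | set => simp only [DeepInf.splitD, splitTerm]; fun_prop
  | multiset =>
    -- The sum of two counts is computed as one count in the concatenation, which avoids a program
    -- for addition.
    have : PT (fun a => Deriv.andD ((D a).map fun u =>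
      form (DeepInf.termF .multiset ((X a ++ Y a).count u) u))) := by fun_prop
    exact this.congr fun a => by simp only [DeepInf.splitD, splitTerm, List.count_append]

@[fun_prop]
theorem PT.andAx {k n m : α → ℕ} {s t : α → TermList} (hk : PT k) (hn : PT n) (hm : PT m)
    (hs : PT s) (ht : PT t) : PT (fun a => DeepInf.andAx (k a) (n a) (m a) (s a) (t a)) := by
  unfold DeepInf.andAx; fun_prop

@[fun_prop]
theorem PT.resAx {S : Setting} {n : α → ℕ} {s : α → TermList} {E : α → Clause} (hn : PT n)
    (hs : PT s) (hE : PT E) : PT (fun a => DeepInf.resAx S (n a) (s a) (E a)) := by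
  unfold DeepInf.resAx; fun_prop

@[fun_prop]
theorem PT.cutD {S : Setting} {D X Y W A B : α → Clause} {Φ : α → Deriv} (hD : PT D) (hX : PT X)
    (hY : PT Y) (hW : PT W) (hA : PT A) (hB : PT B) (hΦ : PT Φ) :
    PT (fun a => DeepInf.cutD S (D a) (X a) (Y a) (W a) (A a) (B a) (Φ a)) := by
  unfold DeepInf.cutD; fun_prop

@[fun_prop]
theorem PT.canon {V t : α → List Literal} (hV : PT V) (ht : PT t) :
    PT (fun a => DeepInf.canon (V a) (t a)) := by
  unfold DeepInf.canon; fun_prop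

theorem sz_erase_le {β : Type} [Enc β] [DecidableEq β] (l : List β) (b : β) :
    sz (l.erase b) ≤ sz l := by
  induction l with
  | nil => simp
  | cons x l ih =>
    by_cases h : x = b
    · simp [h]; omega
    · simpa [h] using ih

@[fun_prop]
theorem PT.rest {S : Setting} {X Y : α → Clause} (hX : PT X) (hY : PT Y) :
    PT (fun a => DeepInf.rest S (X a) (Y a)) := by
  cases S with
  | set => unfold DeepInf.rest; fun_prop
  | multiset =>
    refine (PT.listRec (l := Y) (c := X) (h := fun _ y _ => y) (k := fun y Z => Z.erase y) hY hX
      (by fun_prop) (by fun_prop) ⟨0, fun d r => by simpa using sz_erase_le r d⟩).congr fun a => ?_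
    unfold DeepInf.rest
    induction Y a with
    | nil => rfl
    | cons x l ih => simp [DeepInf.listRec, ih]

@[fun_prop]
theorem PT.taken {S : Setting} {X Y : α → Clause} (hX : PT X) (hY : PT Y) :
    PT (fun a => DeepInf.taken S (X a) (Y a)) := by
  unfold DeepInf.taken; fun_prop

@[fun_prop]
theorem PT.disj {S : Setting} {e : α → Env} {xs : α → List Clause} (he : PT e) (hx : PT xs) :
    PT (fun a => DeepInf.disj S (e a) (xs a)) := by
  unfold DeepInf.disj; fun_prop

@[fun_prop]
theorem PT.oneCand {S : Setting} {e : α → Env} {xs : α → List Clause} {P : α → Clause}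
    (he : PT e) (hx : PT xs) (hP : PT P) :
    PT (fun a => DeepInf.oneCand S (e a) (xs a) (P a)) := by
  unfold DeepInf.oneCand; fun_prop

@[fun_prop]
theorem PT.cutCand {S : Setting} {e : α → Env} {xs : α → List Clause} {P Q T U W : α → Clause}
    {Φ : α → Deriv} (he : PT e) (hx : PT xs) (hP : PT P) (hQ : PT Q) (hT : PT T) (hU : PT U)
    (hW : PT W) (hΦ : PT Φ) :
    PT (fun a => DeepInf.cutCand S (e a) (xs a) (P a) (Q a) (T a) (U a) (W a) (Φ a)) := by
  unfold DeepInf.cutCand; fun_prop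

@[fun_prop]
theorem PT.maxLength {A B : α → Clause} (hA : PT A) (hB : PT B) :
    PT (fun a => DeepInf.maxLength (A a) (B a)) := by
  unfold DeepInf.maxLength; fun_prop

@[fun_prop]
theorem PT.andCand {S : Setting} {e : α → Env} {xs : α → List Clause} {P Q : α → Clause}
    {s t : α → TermList} (he : PT e) (hx : PT xs) (hP : PT P) (hQ : PT Q) (hs : PT s)
    (ht : PT t) : PT (fun a => DeepInf.andCand S (e a) (xs a) (P a) (Q a) (s a) (t a)) := by
  unfold DeepInf.andCand; fun_prop

@[fun_prop]
theorem PT.duals {s : α → TermList} (hs : PT s) : PT (fun a => DeepInf.duals (s a)) := by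
  unfold DeepInf.duals; fun_prop

@[fun_prop]
theorem PT.resCand {S : Setting} {e : α → Env} {xs : α → List Clause} {P Q : α → Clause}
    {s : α → TermList} (he : PT e) (hx : PT xs) (hP : PT P) (hQ : PT Q) (hs : PT s) :
    PT (fun a => DeepInf.resCand S (e a) (xs a) (P a) (Q a) (s a)) := by
  unfold DeepInf.resCand; fun_prop

/-! ### Case distinction on justifications -/

def Justification.fst : Justification → ℕ
  | .hyp r => r
  | .wk i => i
  | .and i _ => i
  | .res i _ => i

def Justification.snd : Justification → ℕ
  | .and _ j => j
  | .res _ j => j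
  | _ => 0

@[fun_prop]
theorem PT.justFst {f : α → Justification} (hf : PT f) : PT (fun a => (f a).fst) := by
  have : PT (fun j : Justification => (Enc.enc j : SExp).cdr.car) := by fun_prop
  exact PT.comp (g := Justification.fst)
    (PT.of_enc (this.congr fun j => by cases j <;> rfl)) hf

@[fun_prop]
theorem PT.justSnd {f : α → Justification} (hf : PT f) : PT (fun a => (f a).snd) := by
  have : PT (fun j : Justification => (Enc.enc j : SExp).cdr.cdr.car) := by fun_prop
  exact PT.comp (g := Justification.snd)
    (PT.of_enc (this.congr fun j => by cases j <;> rfl)) hf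

theorem PT.justCases {j : α → Justification} {f₀ f₁ : α → ℕ → β} {f₂ f₃ : α → ℕ → ℕ → β}
    (hj : PT j) (h₀ : PT (fun p : α × ℕ => f₀ p.1 p.2)) (h₁ : PT (fun p : α × ℕ => f₁ p.1 p.2))
    (h₂ : PT (fun p : α × ℕ × ℕ => f₂ p.1 p.2.1 p.2.2))
    (h₃ : PT (fun p : α × ℕ × ℕ => f₃ p.1 p.2.1 p.2.2)) :
    PT (fun a => Justification.casesOn (motive := fun _ => β) (j a) (f₀ a) (f₁ a) (f₂ a)
      (f₃ a)) := by
  have hc : ∀ n : ℕ, PT (fun a => decide ((Enc.enc (j a) : SExp).car = .sym n)) := by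
    intro n; fun_prop
  have h1 : PT (fun a => (a, (j a).fst)) := by fun_prop
  have h2 : PT (fun a => (a, (j a).fst, (j a).snd)) := by fun_prop
  refine (PT.cond (hc 0) (h₀.comp h1) (PT.cond (hc 1) (h₁.comp h1)
    (PT.cond (hc 2) (h₂.comp h2) (h₃.comp h2)))).congr fun a => ?_
  cases j a <;> rfl

@[fun_prop]
theorem PT.cands {S : Setting} {e : α → Env} {xs : α → List Clause} {j : α → Justification}
    (he : PT e) (hx : PT xs) (hj : PT j) :
    PT (fun a => DeepInf.cands S (e a) (xs a) (j a)) := by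
  refine (PT.justCases hj
    (f₀ := fun a r => (e a).2.2.2[r]?.toList.map fun h =>
      (h.1, Deriv.embed h.2 (DeepInf.disj S (e a) (xs a))))
    (f₁ := fun a i => (xs a).reverse[i]?.toList.map fun P => DeepInf.oneCand S (e a) (xs a) P)
    (f₂ := fun a i j => (xs a).reverse[i]?.toList.flatMap fun P =>
      (xs a).reverse[j]?.toList.flatMap fun Q =>
      DeepInf.oneCand S (e a) (xs a) P :: DeepInf.oneCand S (e a) (xs a) Q ::
        P.flatMap fun s => Q.map fun t => DeepInf.andCand S (e a) (xs a) P Q s t)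
    (f₃ := fun a i j => (xs a).reverse[i]?.toList.flatMap fun P =>
      (xs a).reverse[j]?.toList.flatMap fun Q =>
      DeepInf.oneCand S (e a) (xs a) P :: DeepInf.oneCand S (e a) (xs a) Q ::
        P.map fun s => DeepInf.resCand S (e a) (xs a) P Q s)
    (by fun_prop) (by fun_prop) (by fun_prop) (by fun_prop)).congr fun a => ?_
  cases j a <;> rfl

@[fun_prop]
theorem PT.choose {S : Setting} {e : α → Env} {xs : α → List Clause}
    {x : α → Clause × Justification} (he : PT e) (hx : PT xs) (hj : PT x) :
    PT (fun a => DeepInf.choose S (e a) (xs a) (x a)) := by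
  unfold DeepInf.choose fits; fun_prop

end

end DeepInf

namespace DeepInf

open Formula Deriv Polynomial

/-! ### Removal of terms -/

/-- Containment of clauses, as multisets or as sets. -/
def Setting.Le : Setting → Multiset TermList → Multiset TermList → Prop
  | .multiset, X, Y => X ≤ Y
  | .set, X, Y => X ⊆ Y

theorem Setting.Le.refl (S : Setting) (X : Multiset TermList) : S.Le X X := by
  cases S
  · exact le_refl X
  · exact Multiset.Subset.refl X

theorem Setting.Le.trans {S : Setting} {X Y Z : Multiset TermList} (h : S.Le X Y)
    (h' : S.Le Y Z) : S.Le X Z := by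
  cases S
  · exact le_trans (α := Multiset TermList) h h'
  · exact Multiset.Subset.trans h h'

theorem Setting.Le.of_le (S : Setting) {X Y : Multiset TermList} (h : X ≤ Y) : S.Le X Y := by
  cases S
  · exact h
  · exact Multiset.subset_of_le h

theorem Setting.Le.subset {S : Setting} {X Y : Multiset TermList} (h : S.Le X Y) : X ⊆ Y := by
  cases S
  · exact Multiset.subset_of_le h
  · exact h

theorem coe_rest_multiset (X Y : Clause) :
    ((rest .multiset X Y : Clause) : Multiset TermList) = (X : Multiset TermList) - Y := by
  induction Y with
  | nil => simp [rest]
  | cons y Y ih =>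
    change (((rest .multiset X Y).erase y : Clause) : Multiset TermList) = _
    rw [← Multiset.coe_erase, ih, ← Multiset.cons_coe, ← Multiset.singleton_add,
      tsub_add_eq_tsub_tsub_swap, Multiset.sub_singleton]

theorem rest_le (S : Setting) (X Y : Clause) :
    ((rest S X Y : Clause) : Multiset TermList) ≤ X := by
  cases S with
  | multiset => rw [coe_rest_multiset]; exact tsub_le_self
  | set => exact Multiset.coe_le.2 List.filter_sublist.subperm

theorem perm_rest_taken (S : Setting) (X Y : Clause) : (rest S X Y ++ taken S X Y).Perm X := by
  rw [← Multiset.coe_eq_coe, ← Multiset.coe_add, taken, coe_rest_multiset]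
  exact add_tsub_cancel_of_le (rest_le S X Y)

theorem length_rest_taken (S : Setting) (X Y : Clause) :
    (rest S X Y).length + (taken S X Y).length = X.length := by
  rw [← List.length_append, (perm_rest_taken S X Y).length_eq]

theorem mem_taken {S : Setting} {X Y : Clause} {u : TermList} (h : u ∈ taken S X Y) :
    u ∈ X ∧ u ∈ Y := by
  refine ⟨(perm_rest_taken S X Y).subset (List.mem_append_right _ h), ?_⟩
  change u ∈ ((rest .multiset X (rest S X Y) : Clause) : Multiset TermList) at h
  rw [coe_rest_multiset, Multiset.mem_sub] at h
  by_contra hu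
  cases S with
  | multiset =>
    rw [coe_rest_multiset, Multiset.count_sub,
      Multiset.count_eq_zero_of_notMem (show u ∉ (Y : Multiset TermList) from hu)] at h
    omega
  | set =>
    rw [Multiset.coe_count, Multiset.coe_count, rest, List.count_filter (by simpa using hu)] at h
    omega

/-- For sets `rest` removes all copies of a term, so none occurs on both sides. This provides the
disjointness that `From_cutD` requires. -/
theorem rest_disjoint_taken (S : Setting) (X Y : Clause) :
    S = .multiset ∨ ∀ u ∈ rest S X Y, u ∉ taken S X Y := by
  cases S with
  | multiset => exact .inl rfl
  | set =>
    refine .inr fun u hu h => ?_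
    have h2 := (mem_taken h).2
    simp [rest] at hu
    exact hu.2 h2

theorem taken_singleton (S : Setting) (X : Clause) (s : TermList) :
    taken S X [s] = List.replicate (taken S X [s]).length s :=
  List.eq_replicate_of_mem fun _ hu => List.mem_singleton.1 (mem_taken hu).2

theorem taken_pos {S : Setting} {X : Clause} {s : TermList} (h : s ∈ X) :
    1 ≤ (taken S X [s]).length := by
  rw [Nat.one_le_iff_ne_zero]
  intro h0
  rw [List.length_eq_zero_iff] at h0
  have hp := perm_rest_taken S X [s]
  rw [h0, List.append_nil] at hp
  cases S with
  | multiset =>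
    have h1 := hp.length_eq
    have h2 := congrArg Multiset.card (coe_rest_multiset X [s])
    rw [Multiset.coe_singleton, Multiset.sub_singleton, Multiset.card_erase_of_mem h] at h2
    have h3 := List.length_pos_of_mem h
    simp only [Multiset.coe_card, Nat.pred_eq_sub_one] at h2
    omega
  | set =>
    have := hp.symm.subset h
    simp [rest] at this

/-- From a multiset exactly one copy is removed, so there the rules act with multiplicity 1. -/
theorem taken_linear (S : Setting) {X : Clause} {s : TermList} (h : s ∈ X) :
    S.Linear (taken S X [s]).length := by
  rintro rfl
  have h1 := length_rest_taken .multiset X [s]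
  have h2 := congrArg Multiset.card (coe_rest_multiset X [s])
  rw [Multiset.coe_singleton, Multiset.sub_singleton, Multiset.card_erase_of_mem h] at h2
  have h3 := List.length_pos_of_mem h
  simp only [Multiset.coe_card, Nat.pred_eq_sub_one] at h2
  omega

theorem rest_eq_nil {S : Setting} {X C : Clause} : rest S X C = [] ↔ S.Le X C := by
  cases S with
  | multiset =>
    rw [← Multiset.coe_eq_zero, coe_rest_multiset]
    exact tsub_eq_zero_iff_le
  | set =>
    simp only [rest, List.filter_eq_nil_iff, Bool.not_eq_true', decide_eq_false_iff_not, not_not]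
    exact Iff.rfl

theorem rest_Le {S : Setting} {X Y : Clause} {Γ : Multiset TermList} (h : S.Le X (Γ + ↑Y)) :
    S.Le (rest S X Y : Clause) Γ := by
  cases S with
  | multiset =>
    change ((rest .multiset X Y : Clause) : Multiset TermList) ≤ Γ
    rw [coe_rest_multiset]
    exact tsub_le_iff_right.2 h
  | set =>
    intro u hu
    change u ∈ X.filter _ at hu
    simp only [List.mem_filter, Bool.not_eq_true', decide_eq_false_iff_not] at hu
    rcases Multiset.mem_add.1 (h hu.1) with h1 | h1
    · exact h1
    · exact absurd h1 hu.2

theorem Setting.Le.of_notMem {S : Setting} {X Γ : Multiset TermList} {s : TermList}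
    (h : S.Le X (Γ + {s})) (hs : s ∉ X) : S.Le X Γ := by
  cases S with
  | multiset =>
    change X ≤ Γ + {s} at h
    rw [add_comm, Multiset.singleton_add] at h
    exact (Multiset.le_cons_of_notMem hs).1 h
  | set =>
    intro u hu
    rcases Multiset.mem_add.1 (h hu) with h1 | h1
    · exact h1
    · exact absurd (Multiset.mem_singleton.1 h1 ▸ hu) hs

theorem maxLength_eq (A B : Clause) : maxLength A B = max A.length B.length := by
  simp [maxLength]; omega

theorem fits_iff {S : Setting} {e : Env} {C X : Clause} :
    fits S e C X = true ↔ S.Le X C ∧ X.length ≤ e.2.2.1 := by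
  simp [fits, rest_eq_nil]

/-- Valid on every input, hence usable for the time bound, where nothing is known about the
correctness of the refutation. -/
theorem choose_spec (S : Setting) (e : Env) (xs : List Clause) (x : Clause × Justification) :
    choose S e xs x = ([], form .bot) ∨
      choose S e xs x ∈ cands S e xs x.2 ∧ fits S e x.1 (choose S e xs x).1 = true := by
  unfold choose
  rcases h : (cands S e xs x.2).filter fun c => fits S e x.1 c.1 with _ | ⟨c, l⟩
  · rw [h]; exact .inl rfl
  · rw [h]
    have : c ∈ (cands S e xs x.2).filter fun c => fits S e x.1 c.1 := by simp [h]
    exact .inr (List.mem_filter.1 this)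

theorem choose_of_exists {S : Setting} {e : Env} {xs : List Clause} {x : Clause × Justification}
    (h : ∃ c ∈ cands S e xs x.2, fits S e x.1 c.1 = true) :
    choose S e xs x ∈ cands S e xs x.2 ∧ fits S e x.1 (choose S e xs x).1 = true := by
  unfold choose
  rcases h' : (cands S e xs x.2).filter fun c => fits S e x.1 c.1 with _ | ⟨c, l⟩ <;> rw [h']
  · obtain ⟨c, hc, hf⟩ := h
    have : c ∈ (cands S e xs x.2).filter fun c => fits S e x.1 c.1 := List.mem_filter.2 ⟨hc, hf⟩
    simp [h'] at this
  · have : c ∈ (cands S e xs x.2).filter fun c => fits S e x.1 c.1 := by simp [h']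
    exact List.mem_filter.1 this

/-! ### The whole translation takes polynomial time -/

theorem sz_le_of_forall {α : Type} [Enc α] {l : List α} {M : ℕ} (h : ∀ a ∈ l, sz a ≤ M) :
    sz l ≤ l.length * (M + 1) + 1 := by
  induction l with
  | nil => simp
  | cons a l ih =>
    have h1 := h a (by simp)
    have h2 := ih fun b hb => h b (by simp [hb])
    simp only [sz_cons, List.length_cons]
    rw [add_mul, one_mul]
    omega

theorem sz_le_of_mem {α : Type} [Enc α] {l : List α} {a : α} (h : a ∈ l) : sz a ≤ sz l := by
  induction l with
  | nil => simp at h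
  | cons b l ih =>
    rcases List.mem_cons.1 h with rfl | h
    · simp; omega
    · have := ih h; simp; omega

theorem le_sz_nat (n : ℕ) : n ≤ sz n := by
  have : sz n = sz (List.replicate n ()) := by simp [sz, Enc.enc, natCode]
  rw [this]
  simpa using length_le_sz (List.replicate n ())

/-- The test limits the length, and the terms come from the given line. The bound is independent of
`xs`, so clauses cannot grow from line to line. -/
theorem sz_choose_le (S : Setting) (e : Env) (xs : List Clause) (x : Clause × Justification) :
    sz (choose S e xs x).1 ≤ sz e * (sz x + 1) + 1 := by
  rcases choose_spec S e xs x with h | ⟨-, h⟩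
  · rw [h]; simp
  · obtain ⟨h1, h2⟩ := fits_iff.1 h
    refine (sz_le_of_forall (M := sz x) fun u hu => ?_).trans ?_
    · have := sz_le_of_mem (l := x.1) (h1.subset hu)
      have := sz_pair' x
      omega
    · have h3 := le_sz_nat e.2.2.1
      have h4 := sz_pair' e
      have h5 := sz_pair' e.2
      have h6 := sz_pair' e.2.2
      have := Nat.mul_le_mul_right (sz x + 1)
        (show (choose S e xs x).1.length ≤ sz e by omega)
      omega

section
variable {α : Type} [Enc α]

@[fun_prop]
theorem PT.states {S : Setting} {e : α → Env} {l : α → List (Clause × Justification)}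
    (he : PT e) (hl : PT l) : PT (fun a => DeepInf.states S (e a) (l a)) := by
  -- The choice for a line inspects the recursive value, so `PT.listRec` does not apply; the bound
  -- on the increment comes from `sz_choose_le`.
  refine ((PT.listRec' (c := fun _ : Env => ([] : List Clause))
    (g := fun e x _ xs => (DeepInf.choose S e xs x).1 :: xs) (by fun_prop) (by fun_prop)
    ⟨X * (X + 1) + 2, fun e x l r => ?_⟩).comp (he.pair hl)).congr fun a => ?_
  · have h1 := sz_choose_le S e r x
    have h2 := Nat.mul_le_mul (show sz e ≤ sz e + sz x + sz l by omega)
      (show sz x + 1 ≤ sz e + sz x + sz l + 1 by omega)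
    simp only [sz_cons, eval_add, eval_mul, eval_X, eval_one, eval_ofNat]
    omega
  · simp only
    induction l a with
    | nil => rfl
    | cons x l ih => simp [DeepInf.listRec, DeepInf.states, ih]

@[fun_prop]
theorem PT.translate {S : Setting} {e : α → Env} {l : α → List (Clause × Justification)}
    (he : PT e) (hl : PT l) : PT (fun a => DeepInf.translate S (e a) (l a)) := by
  -- The clauses of the earlier lines are recomputed from each tail, so the recursive derivation is
  -- used just once.
  refine (PT.listRec (c := fun a => form (Formula.orL (DeepInf.disj S (e a) [])))
    (h := fun a x l => (Deriv.or (DeepInf.choose S (e a) (DeepInf.states S (e a) l) x).2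
      (form (Formula.orL (DeepInf.disj S (e a) (DeepInf.states S (e a) l)))),
      Deriv.contr (Formula.orL (DeepInf.disj S (e a) (DeepInf.states S (e a) l)))))
    (k := fun d r => infer .equ d.1 (infer .equ d.2 r)) hl (by fun_prop) (by fun_prop)
    (by fun_prop) ⟨15, fun d r => ?_⟩).congr fun a => ?_
  · have := sz_pair' d
    rw [sz_derivInfer, sz_derivInfer]; omega
  · induction l a with
    | nil => rfl
    | cons x l ih => simp [DeepInf.listRec, ih, DeepInf.translate]

@[fun_prop]
theorem PT.lineClause {f : α → Line} (hf : PT f) : PT (fun a => (f a).clause) :=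
  PT.comp (g := Line.clause) (PT.car_of fun _ => rfl) hf

@[fun_prop]
theorem PT.lineJust {f : α → Line} (hf : PT f) : PT (fun a => (f a).just) :=
  PT.comp (g := Line.just) (PT.cdr_of fun _ => rfl) hf

@[fun_prop]
theorem PT.literals {Γs : α → List Clause} {π : α → List Line} (hΓ : PT Γs) (hπ : PT π) :
    PT (fun a => DeepInf.literals (Γs a) (π a)) := by
  unfold DeepInf.literals; fun_prop

@[fun_prop]
theorem PT.canonLines {V : α → List Literal} {π : α → List Line} (hV : PT V) (hπ : PT π) :
    PT (fun a => DeepInf.canonLines (V a) (π a)) := by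
  unfold DeepInf.canonLines; fun_prop

@[fun_prop]
theorem PT.canonHyps {V : α → List Literal} {Γs : α → List Clause} (hV : PT V) (hΓ : PT Γs) :
    PT (fun a => DeepInf.canonHyps (V a) (Γs a)) := by
  unfold DeepInf.canonHyps; fun_prop

@[fun_prop]
theorem PT.env {Γs : α → List Clause} {π : α → List Line} (hΓ : PT Γs) (hπ : PT π) :
    PT (fun a => DeepInf.env (Γs a) (π a)) := by
  unfold DeepInf.env; fun_prop

@[fun_prop]
theorem PT.target {Γs : α → List Clause} (hΓ : PT Γs) :
    PT (fun a => DeepInf.target (Γs a)) := by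
  unfold DeepInf.target; fun_prop

theorem PT.simulate (S : Setting) : PT (DeepInf.simulate S) := by
  unfold DeepInf.simulate; fun_prop

end

theorem Deriv.size_le_sz (Φ : Deriv) : Φ.size ≤ sz Φ := by
  have hF : ∀ A : Formula, A.size ≤ sz A := by
    intro A
    induction A with
    | and A B ihA ihB => rw [sz_formulaAnd, Formula.size]; omega
    | or A B ihA ihB => rw [sz_formulaOr, Formula.size]; omega
    | _ => simp [Formula.size, sz_pos]
  induction Φ with
  | form A => have := hF A; rw [sz_derivForm, Deriv.size]; omega
  | and Φ Ψ h1 h2 => rw [sz_derivAnd, Deriv.size]; omega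
  | or Φ Ψ h1 h2 => rw [sz_derivOr, Deriv.size]; omega
  | infer ρ Φ Ψ h1 h2 => rw [sz_derivInfer, Deriv.size]; omega

/-- It remains to show that the translation is correct. -/
theorem ksPolySimulates_of_simulate {S : Setting} {T : List Clause → List Line → Prop}
    (h : ∀ Γs π, T Γs π → (simulate S (Γs, π)).IsKSProof (toFormula Γs).dual) :
    KSPolySimulates T := by
  obtain ⟨p, q, hp⟩ := PT.simulate S
  refine ⟨p, q, fun Γs π hT => ?_⟩
  obtain ⟨t, h1, h2⟩ := hp (Γs, π)
  exact ⟨_, t, h1, h2, (Deriv.size_le_sz _).trans (h1.size_le.trans h2), h Γs π hT⟩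

end DeepInf

namespace DeepInf

open Formula Deriv

/-! ### Normal forms of terms -/

theorem mem_canon {V t : List Literal} {a : Literal} (h : a ∈ canon V t) : a ∈ V := by
  obtain ⟨b, hb, h⟩ := List.mem_flatMap.1 h
  exact List.eq_of_mem_replicate h ▸ hb

theorem count_canon {V : List Literal} (hV : V.Nodup) (t : List Literal) {a : Literal}
    (ha : a ∈ V) : (canon V t).count a = t.count a := by
  induction V with
  | nil => simp at ha
  | cons b V ih =>
    rw [List.nodup_cons] at hV
    have h1 : canon (b :: V) t = List.replicate (t.count b) b ++ canon V t := rfl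
    rw [h1, List.count_append]
    by_cases hab : a = b
    · subst hab
      rw [List.count_replicate_self, List.count_eq_zero.2 fun h => hV.1 (mem_canon h), add_zero]
    · rw [ih hV.2 ((List.mem_cons.1 ha).resolve_left hab),
        List.count_eq_zero.2 fun h => hab (List.eq_of_mem_replicate h), zero_add]

theorem canon_perm {V t : List Literal} (hV : V.Nodup) (ht : t ⊆ V) : (canon V t).Perm t := by
  rw [List.perm_iff_count]
  intro a
  by_cases ha : a ∈ V
  · exact count_canon hV t ha
  · rw [List.count_eq_zero.2 fun h => ha (mem_canon h), List.count_eq_zero.2 fun h => ha (ht h)]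

/-- The normal form of a term given as a multiset. -/
def canonM (V : List Literal) (s : Term) : TermList :=
  V.flatMap fun a => List.replicate (s.count a) a

theorem canonM_coe (V t : List Literal) : canonM V (t : Multiset Literal) = canon V t := by
  simp [canonM, canon]

theorem canonM_add {V : List Literal} (hV : V.Nodup) (s t : Term) :
    canonM V (s + t) = canon V (canonM V s ++ canonM V t) := by
  induction s using Quotient.inductionOn with | _ s
  induction t using Quotient.inductionOn with | _ t
  simp only [Multiset.quot_mk_to_coe, Multiset.coe_add, canonM_coe]
  simp only [canon, List.flatMap]
  congr 1
  refine List.map_congr_left fun a ha => ?_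
  have h1 := count_canon hV s ha
  have h2 := count_canon hV t ha
  simp only [canon, List.flatMap] at h1 h2
  rw [List.count_append, List.count_append, h1, h2]

theorem coe_canonM {V : List Literal} (hV : V.Nodup) {s : Term} (hs : ∀ a ∈ s, a ∈ V) :
    (canonM V s : Multiset Literal) = s := by
  induction s using Quotient.inductionOn with | _ s
  rw [Multiset.quot_mk_to_coe, canonM_coe, Multiset.coe_eq_coe]
  exact canon_perm hV hs

theorem canonM_singleton {V : List Literal} (hV : V.Nodup) {a : Literal} (ha : a ∈ V) :
    canonM V {a} = [a] := by
  have := coe_canonM hV (s := {a}) (by simpa using ha)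
  exact Multiset.coe_eq_singleton.1 this

/-- The clauses of the translation that belong to a clause. -/
def canonC (V : List Literal) (Γ : Multiset Term) : Multiset TermList := Γ.map (canonM V)

theorem canonC_terms (V : List Literal) (C : Clause) :
    canonC V C.terms = ((C.map fun t => canon V t : Clause) : Multiset TermList) := by
  simp only [canonC, Clause.terms, Multiset.map_coe, List.map_map]
  congr 1
  exact List.map_congr_left fun t _ => canonM_coe V t

theorem Setting.Same.symm {S : Setting} {Γ Δ : Multiset Term} (h : S.Same Γ Δ) : S.Same Δ Γ := by
  cases S <;> exact Eq.symm h

theorem Setting.Same.mem {S : Setting} {Γ Δ : Multiset Term} (h : S.Same Γ Δ) {s : Term}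
    (hs : s ∈ Γ) : s ∈ Δ := by
  cases S with
  | multiset => exact (show Γ = Δ from h) ▸ hs
  | set => exact Multiset.mem_toFinset.1 ((show Γ.toFinset = Δ.toFinset from h) ▸
      Multiset.mem_toFinset.2 hs)

theorem Setting.Same.Le {S : Setting} {Γ Δ : Multiset Term} (h : S.Same Γ Δ) (V : List Literal) :
    S.Le (canonC V Γ) (canonC V Δ) := by
  cases S with
  | multiset => exact (show Γ = Δ from h) ▸ Setting.Le.refl .multiset _
  | set =>
    intro u hu
    obtain ⟨s, hs, rfl⟩ := Multiset.mem_map.1 hu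
    exact Multiset.mem_map_of_mem _ (Setting.Same.mem h hs)

/-! ### Soundness of the candidates -/

/-- What the data of the translation have to satisfy. -/
structure Env.Good (S : Setting) (e : Env) : Prop where
  nodupV : e.1.Nodup
  nodupD : e.2.1.Nodup
  mem : ∀ u ∈ e.2.1, u ⊆ e.1
  hyps : ∀ h ∈ e.2.2.2, h.2.q = (clauseF S e.2.1 h.1).q

theorem From_embed_clause {S : Setting} {e : Env} {xs : List Clause} {P : Clause} (h : P ∈ xs) :
    (embed (clauseF S e.2.1 P) (disj S e xs)).From (clauseF S e.2.1 P).q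
      (orL (disj S e xs)).q :=
  .embed (List.mem_append_left _ (List.mem_map_of_mem h))

theorem From_cutCand {S : Setting} {e : Env} {xs : List Clause} {P Q T U W : Clause} {Φ : Deriv}
    (hP : P ∈ xs) (hQ : Q ∈ xs)
    (h : Φ.From (clauseF S e.2.1 W).q
      ((clauseF S e.2.1 (taken S P T)).q + (clauseF S e.2.1 (taken S Q U)).q)) :
    (cutCand S e xs P Q T U W Φ).2.From (clauseF S e.2.1 (cutCand S e xs P Q T U W Φ).1).q
      (orL (disj S e xs)).q := by
  have h1 := From_cutD h (rest_disjoint_taken S P T) (rest_disjoint_taken S Q U)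
  rw [clauseF_congr S e.2.1 (perm_rest_taken S P T),
    clauseF_congr S e.2.1 (perm_rest_taken S Q U)] at h1
  exact h1.trans (((From_embed_clause hP).or (From_embed_clause hQ)).trans (.contr _))

theorem clauseF_taken {S : Setting} {D P : Clause} {s : TermList} (hD : D.Nodup) (hs : s ∈ D) :
    (clauseF S D (taken S P [s])).q = (termF S (taken S P [s]).length s).q := by
  conv_lhs => rw [taken_singleton S P s]
  exact clauseF_replicate hD hs _

/-- Whichever terms the rule is taken to act on, the candidate comes with a correct derivation; the
program need not recover those that the refutation had in mind. -/
theorem From_cands {S : Setting} {e : Env} (he : e.Good S) {xs : List Clause}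
    (hxs : ∀ X ∈ xs, X ⊆ e.2.1) {C : Clause} (hC : C ⊆ e.2.1) {j : Justification}
    {c : Clause × Deriv} (hc : c ∈ cands S e xs j) (hf : S.Le c.1 C) :
    c.2.From (clauseF S e.2.1 c.1).q (orL (disj S e xs)).q := by
  have hmem : ∀ {i : ℕ} {P : Clause}, P ∈ xs.reverse[i]?.toList → P ∈ xs := by
    intro i P h
    rw [Option.mem_toList] at h
    exact List.mem_reverse.1 (List.mem_of_getElem? h)
  cases j with
  | hyp r =>
    obtain ⟨h, hh, rfl⟩ := List.mem_map.1 hc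
    rw [Option.mem_toList] at hh
    have hh := List.mem_of_getElem? hh
    exact (From.embed (List.mem_append_right _ (List.mem_map_of_mem hh))).congr
      (he.hyps h hh) rfl
  | wk i =>
    obtain ⟨P, hP, rfl⟩ := List.mem_map.1 hc
    exact From_embed_clause (hmem hP)
  | and i j =>
    obtain ⟨P, hP, hc⟩ := List.mem_flatMap.1 hc
    obtain ⟨Q, hQ, hc⟩ := List.mem_flatMap.1 hc
    replace hP := hmem hP
    replace hQ := hmem hQ
    rcases List.mem_cons.1 hc with rfl | hc
    · exact From_embed_clause hP
    rcases List.mem_cons.1 hc with rfl | hc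
    · exact From_embed_clause hQ
    obtain ⟨s, hs, hc⟩ := List.mem_flatMap.1 hc
    obtain ⟨t, ht, rfl⟩ := List.mem_map.1 hc
    have hsD := hxs P hP hs
    have htD := hxs Q hQ ht
    have p1 := taken_pos (S := S) hs
    have p2 := taken_pos (S := S) ht
    refine From_cutCand hP hQ ?_
    rw [clauseF_taken he.nodupD hsD, clauseF_taken he.nodupD htD, clauseF_replicate he.nodupD]
    · refine From_andAx (fun hS => ?_) p1 p2 ?_ ?_
        (canon_perm he.nodupV (List.append_subset.2 ⟨he.mem s hsD, he.mem t htD⟩))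
      · rw [maxLength_eq, taken_linear S hs hS, taken_linear S ht hS, max_self]
      · rw [maxLength_eq]; exact le_max_left _ _
      · rw [maxLength_eq]; exact le_max_right _ _
    -- `clauseF` sees only terms listed in `D`. The normal form of `s ∧ t` is among them because the
    -- candidate is contained in the given line.
    · refine hC (hf.subset ?_)
      change _ ∈ (andCand S e xs P Q s t).1
      refine List.mem_append_right _ (List.mem_append_right _ (List.mem_replicate.2 ⟨?_, rfl⟩))
      rw [maxLength_eq]
      omega
  | res i j =>
    obtain ⟨P, hP, hc⟩ := List.mem_flatMap.1 hc
    obtain ⟨Q, hQ, hc⟩ := List.mem_flatMap.1 hc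
    replace hP := hmem hP
    replace hQ := hmem hQ
    rcases List.mem_cons.1 hc with rfl | hc
    · exact From_embed_clause hP
    rcases List.mem_cons.1 hc with rfl | hc
    · exact From_embed_clause hQ
    obtain ⟨s, hs, rfl⟩ := List.mem_map.1 hc
    have hsD := hxs P hP hs
    refine From_cutCand hP hQ ?_
    rw [clauseF_taken he.nodupD hsD, clauseF_nil]
    refine From_resAx (taken_linear S hs) (by have := taken_pos (S := S) hs; omega) he.nodupD
      (fun u hu => hxs Q hQ (mem_taken hu).1) fun u hu => ?_
    obtain ⟨a, ha, rfl⟩ := List.mem_map.1 (mem_taken hu).2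
    exact ⟨a, ha, rfl⟩

/-! ### Completeness of the candidates -/

theorem Setting.Le.add {S : Setting} {X Y Γ Δ : Multiset TermList} (h : S.Le X Γ)
    (h' : S.Le Y Δ) : S.Le (X + Y) (Γ + Δ) := by
  cases S with
  | multiset => exact add_le_add (α := Multiset TermList) h h'
  | set =>
    intro u hu
    rcases Multiset.mem_add.1 hu with hu | hu
    · exact Multiset.mem_add.2 (.inl (h hu))
    · exact Multiset.mem_add.2 (.inr (h' hu))

/-- The length of the clause of the line number `i`. -/
def lengthAt (xs : List Clause) (i : ℕ) : ℕ := (xs.reverse[i]?.getD []).length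

theorem cutCand_length (S : Setting) (e : Env) (xs : List Clause) (P Q T U W : Clause) (Φ : Deriv)
    (hW : W.length ≤ (taken S P T).length + (taken S Q U).length) :
    (cutCand S e xs P Q T U W Φ).1.length ≤ P.length + Q.length := by
  have h1 := length_rest_taken S P T
  have h2 := length_rest_taken S Q U
  simp only [cutCand, List.length_append]
  omega

/-- The terms on which the given step acts yield the candidate, unless one of them has disappeared
from its premiss; then this premiss lies within the side terms and is a candidate itself. Dual
literals missing from the second premiss of a resolution do no harm. -/
theorem exists_cand {S : Setting} {e : Env} (he : e.Good S) {xs : List Clause}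
    {hyps prev : List (Multiset Term)} {j : Justification} {C : Multiset Term}
    (hF : Follows S hyps prev j C)
    (hprev : ∀ (i : ℕ) Γ, prev[i]? = some Γ → ∃ X, xs.reverse[i]? = some X ∧ S.Le X (canonC e.1 Γ))
    (hhyps : ∀ (r : ℕ) G, hyps[r]? = some G → ∃ h : Clause × Formula, e.2.2.2[r]? = some h ∧
      (h.1 : Multiset TermList) = canonC e.1 G)
    (hV : ∀ Γ ∈ prev, ∀ s ∈ Γ, ∀ a ∈ s, a ∈ e.1) :
    ∃ c ∈ cands S e xs j, S.Le c.1 (canonC e.1 C) := by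
  have hadd : ∀ Γ Δ : Multiset Term, canonC e.1 (Γ + Δ) = canonC e.1 Γ + canonC e.1 Δ :=
    fun Γ Δ => Multiset.map_add _ _ _
  have hsub : ∀ {C Γ Δ : Multiset Term}, S.Same C (Γ + Δ) → S.Le (canonC e.1 Γ) (canonC e.1 C) ∧
      S.Le (canonC e.1 Δ) (canonC e.1 C) := by
    intro C Γ Δ h
    refine ⟨.trans (.of_le S ?_) (h.symm.Le e.1), .trans (.of_le S ?_) (h.symm.Le e.1)⟩
    · rw [hadd]; exact Multiset.le_add_right _ _
    · rw [hadd]; exact Multiset.le_add_left _ _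
  cases hF with
  | @hyp r G _ hr hS =>
    obtain ⟨h, hh, hG⟩ := hhyps r G hr
    refine ⟨_, List.mem_map.2 ⟨h, Option.mem_toList.2 hh, rfl⟩, ?_⟩
    simp only [hG]
    exact hS.symm.Le e.1
  | @wk i _ Γ Δ hi hS =>
    obtain ⟨X, hX, hL⟩ := hprev i Γ hi
    exact ⟨_, List.mem_map.2 ⟨X, Option.mem_toList.2 hX, rfl⟩, hL.trans (hsub hS).1⟩
  | @and i j P Q _ Γ Δ s t hi hj hP hQ hC =>
    obtain ⟨X, hX, hXP⟩ := hprev i P hi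
    obtain ⟨Y, hY, hYQ⟩ := hprev j Q hj
    have hmem : ∀ c, c ∈ (oneCand S e xs X :: oneCand S e xs Y ::
        X.flatMap fun s => Y.map fun t => andCand S e xs X Y s t) →
        c ∈ cands S e xs (.and i j) := fun c hc =>
      List.mem_flatMap.2 ⟨X, Option.mem_toList.2 hX,
        List.mem_flatMap.2 ⟨Y, Option.mem_toList.2 hY, hc⟩⟩
    have hXs : S.Le X (canonC e.1 Γ + {canonM e.1 s}) := by
      have := hXP.trans (hP.Le e.1)
      rwa [hadd, canonC, canonC, Multiset.map_singleton] at this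
    have hYt : S.Le Y (canonC e.1 Δ + {canonM e.1 t}) := by
      have := hYQ.trans (hQ.Le e.1)
      rwa [hadd, canonC, canonC, Multiset.map_singleton] at this
    by_cases hs : canonM e.1 s ∈ X
    · by_cases ht : canonM e.1 t ∈ Y
      · refine ⟨andCand S e xs X Y (canonM e.1 s) (canonM e.1 t), hmem _ (List.mem_cons_of_mem _
          (List.mem_cons_of_mem _ (List.mem_flatMap.2 ⟨_, hs, List.mem_map.2 ⟨_, ht, rfl⟩⟩))), ?_⟩
        refine Setting.Le.trans ?_ (hC.symm.Le e.1)
        rw [hadd, hadd, canonC.eq_1 e.1 {s + t}, Multiset.map_singleton, canonM_add he.nodupV,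
          add_assoc]
        simp only [andCand, cutCand, ← Multiset.coe_add]
        refine (rest_Le hXs).add ((rest_Le hYt).add ?_)
        cases S with
        | multiset =>
          rw [maxLength_eq, taken_linear .multiset hs rfl, taken_linear .multiset ht rfl]
          exact Setting.Le.refl .multiset _
        | set =>
          intro u hu
          exact Multiset.mem_singleton.2 (List.eq_of_mem_replicate hu)
      · refine ⟨_, hmem _ (List.mem_cons_of_mem _ List.mem_cons_self),
          (hYt.of_notMem ht).trans ?_⟩
        rw [add_comm Γ, add_assoc] at hC
        exact (hsub hC).1
    · refine ⟨_, hmem _ List.mem_cons_self, (hXs.of_notMem hs).trans ?_⟩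
      rw [add_assoc] at hC
      exact (hsub hC).1
  | @res i j P Q _ Γ Δ s hi hj hP hQ hC =>
    obtain ⟨X, hX, hXP⟩ := hprev i P hi
    obtain ⟨Y, hY, hYQ⟩ := hprev j Q hj
    have hmem : ∀ c, c ∈ (oneCand S e xs X :: oneCand S e xs Y ::
        X.map fun s => resCand S e xs X Y s) →
        c ∈ cands S e xs (.res i j) := fun c hc =>
      List.mem_flatMap.2 ⟨X, Option.mem_toList.2 hX,
        List.mem_flatMap.2 ⟨Y, Option.mem_toList.2 hY, hc⟩⟩
    have hXs : S.Le X (canonC e.1 Γ + {canonM e.1 s}) := by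
      have := hXP.trans (hP.Le e.1)
      rwa [hadd, canonC, canonC, Multiset.map_singleton] at this
    have hsV : ∀ a ∈ s, a ∈ e.1 :=
      hV P (List.mem_of_getElem? hi) s (hP.symm.mem (by simp))
    have hdV : ∀ a ∈ s, a.dual ∈ e.1 := fun a ha =>
      hV Q (List.mem_of_getElem? hj) {a.dual} (hQ.symm.mem (Multiset.mem_add.2
        (.inr (Multiset.mem_map_of_mem _ ha)))) _ (by simp)
    have hd : canonC e.1 (s.map fun a => ({a.dual} : Term)) = (duals (canonM e.1 s) : Clause) := by
      rw [canonC, Multiset.map_map, duals, ← Multiset.map_coe, coe_canonM he.nodupV hsV]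
      exact Multiset.map_congr rfl fun a ha => canonM_singleton he.nodupV (hdV a ha)
    have hYt : S.Le Y (canonC e.1 Δ + (duals (canonM e.1 s) : Clause)) := by
      have := hYQ.trans (hQ.Le e.1)
      rwa [hadd, hd] at this
    by_cases hs : canonM e.1 s ∈ X
    · refine ⟨resCand S e xs X Y (canonM e.1 s), hmem _ (List.mem_cons_of_mem _
        (List.mem_cons_of_mem _ (List.mem_map.2 ⟨_, hs, rfl⟩))), ?_⟩
      refine Setting.Le.trans ?_ (hC.symm.Le e.1)
      rw [hadd]
      simp only [resCand, cutCand, List.append_nil, ← Multiset.coe_add]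
      exact (rest_Le hXs).add (rest_Le hYt)
    · exact ⟨_, hmem _ List.mem_cons_self, (hXs.of_notMem hs).trans (hsub hC).1⟩

/-- Multiplicities at most add up, as the maximum given to a new term does not exceed the sum of
what was removed. Only hypotheses bring in a length of their own. -/
theorem cand_length {S : Setting} {e : Env} {xs : List Clause} {hyps prev : List (Multiset Term)}
    {j : Justification} {C : Multiset Term} (hF : Follows S hyps prev j C)
    (hhyps : ∀ (r : ℕ) G, hyps[r]? = some G → ∃ h : Clause × Formula, e.2.2.2[r]? = some h ∧
      (h.1 : Multiset TermList) = canonC e.1 G)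
    (hnd : S = .set → ∀ G ∈ hyps, G.Nodup) {c : Clause × Deriv} (hc : c ∈ cands S e xs j) :
    c.1.length ≤ Multiset.card C + (j.premisses.map (lengthAt xs)).sum := by
  have hget : ∀ {i : ℕ} {P : Clause}, P ∈ xs.reverse[i]?.toList → lengthAt xs i = P.length := by
    intro i P h
    rw [Option.mem_toList] at h
    rw [lengthAt, Option.mem_def.1 h]
    rfl
  cases j with
  | hyp r =>
    obtain ⟨h, hh, rfl⟩ := List.mem_map.1 hc
    rw [Option.mem_toList] at hh
    cases hF with
    | @hyp _ G _ hr hS =>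
      obtain ⟨h', hh', hG⟩ := hhyps r G hr
      obtain rfl : h' = h := Option.some.inj (hh'.symm.trans hh)
      have h1 : h'.1.length = Multiset.card G := by
        rw [← Multiset.coe_card, hG, canonC, Multiset.card_map]
      simp only [h1]
      refine le_trans ?_ (Nat.le_add_right _ _)
      cases S with
      | multiset => exact (congrArg Multiset.card (show C = G from hS)).ge
      | set =>
        -- The line may write the set differently from the hypothesis, but the hypothesis has no
        -- repetitions and so is not longer.
        rw [← Multiset.toFinset_card_of_nodup (hnd rfl G (List.mem_of_getElem? hr)),
          ← show C.toFinset = G.toFinset from hS]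
        exact Multiset.toFinset_card_le C
  | wk i =>
    obtain ⟨P, hP, rfl⟩ := List.mem_map.1 hc
    simp [oneCand, Justification.premisses, hget hP]
  | and i j =>
    obtain ⟨P, hP, hc⟩ := List.mem_flatMap.1 hc
    obtain ⟨Q, hQ, hc⟩ := List.mem_flatMap.1 hc
    have hlen : ((Justification.and i j).premisses.map (lengthAt xs)).sum =
        P.length + Q.length := by
      simp [Justification.premisses, hget hP, hget hQ]
    rw [hlen]
    rcases List.mem_cons.1 hc with rfl | hc
    · simp only [oneCand]; omega
    rcases List.mem_cons.1 hc with rfl | hc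
    · simp only [oneCand]; omega
    obtain ⟨s, hs, hc⟩ := List.mem_flatMap.1 hc
    obtain ⟨t, ht, rfl⟩ := List.mem_map.1 hc
    refine (cutCand_length S e xs P Q _ _ _ _ ?_).trans (Nat.le_add_left _ _)
    rw [List.length_replicate, maxLength_eq]
    omega
  | res i j =>
    obtain ⟨P, hP, hc⟩ := List.mem_flatMap.1 hc
    obtain ⟨Q, hQ, hc⟩ := List.mem_flatMap.1 hc
    have hlen : ((Justification.res i j).premisses.map (lengthAt xs)).sum =
        P.length + Q.length := by
      simp [Justification.premisses, hget hP, hget hQ]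
    rw [hlen]
    rcases List.mem_cons.1 hc with rfl | hc
    · simp only [oneCand]; omega
    rcases List.mem_cons.1 hc with rfl | hc
    · simp only [oneCand]; omega
    obtain ⟨s, hs, rfl⟩ := List.mem_map.1 hc
    exact (cutCand_length S e xs P Q _ _ _ _ (by simp)).trans (Nat.le_add_left _ _)

theorem Follows.premisses_lt {S : Setting} {hyps prev : List (Multiset Term)} {j : Justification}
    {C : Multiset Term} (hF : Follows S hyps prev j C) : ∀ i ∈ j.premisses, i < prev.length := by
  have : ∀ {i : ℕ} {Γ : Multiset Term}, prev[i]? = some Γ → i < prev.length := fun h =>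
    (List.getElem?_eq_some_iff.1 h).1
  cases hF with
  | hyp => simp [Justification.premisses]
  | wk h => simpa [Justification.premisses] using this h
  | and h h' => simpa [Justification.premisses] using ⟨this h, this h'⟩
  | res h h' => simpa [Justification.premisses] using ⟨this h, this h'⟩

end DeepInf

namespace DeepInf

open Formula Deriv

/-! ### Tree-like derivations -/

/-- In a tree, weights that grow by at most `b i` over the sum of those of the premisses are
bounded by the sum of the `b i`. -/
theorem weight_le_of_tree (prem : List (List ℕ)) (b w : ℕ → ℕ) (hn : (prem.flatMap id).Nodup)
    {m : ℕ} (hm : m < prem.length)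
    (hp : ∀ (i : ℕ) p, prem[i]? = some p → ∀ j ∈ p, j < i)
    (hw : ∀ (i : ℕ) p, i ≤ m → prem[i]? = some p → w i ≤ b i + (p.map w).sum) :
    w m ≤ ∑ i ∈ Finset.range (m + 1), b i := by
  -- The inequalities are summed over all lines; on the right the weights of all premisses used
  -- appear.
  have key : ∀ k ≤ m + 1, ∑ i ∈ Finset.range k, w i ≤
      ∑ i ∈ Finset.range k, b i + (((prem.take k).flatMap id).map w).sum := by
    intro k
    induction k with
    | zero => simp
    | succ k ih =>
      intro hk
      have hk' : k < prem.length := by omega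
      have h1 := ih (by omega)
      have h2 := hw k _ (by omega) (List.getElem?_eq_getElem hk')
      rw [Finset.sum_range_succ, Finset.sum_range_succ, List.take_succ_eq_append_getElem hk',
        List.flatMap_append, List.map_append, List.sum_append]
      simp only [List.flatMap_singleton, id]
      omega
  have h1 := key (m + 1) le_rfl
  -- The premisses of the lines up to `m` are distinct numbers below `m`, so all weights except `w
  -- m` cancel.
  have h2 : (((prem.take (m + 1)).flatMap id).map w).sum ≤ ∑ i ∈ Finset.range m, w i := by
    have hnd : ((prem.take (m + 1)).flatMap id).Nodup := by
      have h : prem.flatMap id = (prem.take (m + 1)).flatMap id ++ (prem.drop (m + 1)).flatMap id := by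
        rw [← List.flatMap_append, List.take_append_drop]
      rw [h] at hn
      exact (List.nodup_append.1 hn).1
    rw [← List.sum_toFinset _ hnd]
    refine Finset.sum_le_sum_of_subset fun j hj => ?_
    rw [List.mem_toFinset] at hj
    obtain ⟨p, hp', hj⟩ := List.mem_flatMap.1 hj
    obtain ⟨i, hi, rfl⟩ := List.mem_take_iff_getElem.1 hp'
    have := hp i _ (List.getElem?_eq_getElem (by omega)) j hj
    rw [Finset.mem_range]
    omega
  rw [Finset.sum_range_succ] at h1
  omega

theorem sum_range_getD_le (l : List ℕ) (n : ℕ) :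
    ∑ i ∈ Finset.range n, l.getD i 0 ≤ l.sum := by
  induction l generalizing n with
  | nil => simp
  | cons a l ih =>
    cases n with
    | zero => simp
    | succ n =>
      rw [Finset.sum_range_succ', List.sum_cons]
      have := ih n
      simp only [List.getD_cons_succ, List.getD_cons_zero]
      omega

/-! ### Correctness of the translation -/

theorem target_eq (Γs : List Clause) : target Γs = (toFormula Γs).dual := by
  simp only [toFormula, target, dual_bigAnd, List.map_map]
  congr 1
  refine List.map_congr_left fun G _ => ?_
  simp only [Function.comp, dual_bigOr, List.map_map]
  congr 1
  refine List.map_congr_left fun t _ => ?_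
  simp only [Function.comp, dual_bigAnd, List.map_map]
  rfl

theorem q_hypDual (G : Clause) : (andL (G.map fun t => orL (negs t))).q =
    (G.map fun t => (t.map fun a => (lit a.dual).q).sum).prod := by
  simp [negs, Function.comp_def]

theorem q_target (Γs : List Clause) :
    (target Γs).q = (orL (Γs.map fun G => andL (G.map fun t => orL (negs t)))).q := by
  simp only [target, q_bigOr, q_orL, List.map_map]
  congr 1
  refine List.map_congr_left fun G _ => ?_
  simp [q_bigOr, q_bigAnd, negs, Function.comp_def]

section
variable (Γs : List Clause) (π : List Line)

theorem literals_nodup : (literals Γs π).Nodup := List.nodup_dedup _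

variable {Γs π}

theorem subset_literals_of_hyp {G : Clause} (hG : G ∈ Γs) {t : TermList} (ht : t ∈ G) :
    t ⊆ literals Γs π := fun _ ha => List.mem_dedup.2 (List.mem_flatMap.2
  ⟨G, List.mem_append_left _ hG, List.mem_flatMap.2 ⟨t, ht, ha⟩⟩)

theorem subset_literals_of_line {L : Line} (hL : L ∈ π) {t : TermList} (ht : t ∈ L.clause) :
    t ⊆ literals Γs π := fun _ ha => List.mem_dedup.2 (List.mem_flatMap.2
  ⟨L.clause, List.mem_append_right _ (List.mem_map_of_mem hL), List.mem_flatMap.2 ⟨t, ht, ha⟩⟩)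

theorem env_good {S : Setting} (h : ∀ G ∈ Γs, S.WellFormed G) : (env Γs π).Good S where
  nodupV := literals_nodup Γs π
  nodupD := List.nodup_dedup _
  mem u hu := by
    rcases List.mem_append.1 (List.mem_dedup.1 hu) with hu | hu
    · obtain ⟨x, hx, hu⟩ := List.mem_flatMap.1 hu
      obtain ⟨G, hG, rfl⟩ := List.mem_map.1 hx
      obtain ⟨t, ht, rfl⟩ := List.mem_map.1 hu
      exact fun a ha => mem_canon ha
    · obtain ⟨x, hx, hu⟩ := List.mem_flatMap.1 hu
      obtain ⟨L, hL, rfl⟩ := List.mem_map.1 hx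
      obtain ⟨t, ht, rfl⟩ := List.mem_map.1 hu
      exact fun a ha => mem_canon ha
  hyps x hx := by
    obtain ⟨G, hG, rfl⟩ := List.mem_map.1 hx
    have hp : ∀ t ∈ G, (canon (literals Γs π) t).Perm t := fun t ht =>
      canon_perm (literals_nodup Γs π) (subset_literals_of_hyp hG ht)
    rw [clauseF_nodup (D := (env Γs π).2.1) (List.nodup_dedup _), q_hypDual, List.map_map]
    · congr 1
      exact List.map_congr_left fun t ht => (((hp t ht).map _).sum_eq).symm
    · intro u hu
      exact List.mem_dedup.2 (List.mem_append_left _ (List.mem_flatMap.2 ⟨_, hx, hu⟩))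
    · cases S with
      | multiset => exact .inl rfl
      | set =>
        right
        -- A repetition would put proper powers into the formula for the hypothesis. Distinct terms
        -- keep distinct normal forms, since these are permutations of them.
        have h1 : G.terms.Nodup := h G hG
        rw [Clause.terms, Multiset.coe_nodup] at h1
        refine List.Nodup.of_map (Multiset.ofList : List Literal → Multiset Literal) ?_
        rw [List.map_map]
        convert h1 using 1
        exact List.map_congr_left fun t ht => Multiset.coe_eq_coe.2 (hp t ht)

theorem cap_eq : (env Γs π).2.2.1 = (π.map fun L => L.clause.length).sum := by
  simp [env, canonLines, List.length_flatMap, Function.comp_def]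

/-- What is known about the lines before the line number `m`. -/
structure Correct (S : Setting) (Γs : List Clause) (π : List Line) (m : ℕ) : Prop where
  length : (states S (env Γs π) ((canonLines (literals Γs π) π).take m).reverse).length = m
  lines : ∀ i < m, ∀ L, π[i]? = some L → ∃ X,
    (states S (env Γs π) ((canonLines (literals Γs π) π).take m).reverse).reverse[i]? = some X ∧
    S.Le X (canonC (literals Γs π) L.clause.terms) ∧
    X.length ≤ L.clause.length + (L.just.premisses.map (lengthAt
      (states S (env Γs π) ((canonLines (literals Γs π) π).take m).reverse))).sum
  from_ : (translate S (env Γs π) ((canonLines (literals Γs π) π).take m).reverse).From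
    (orL (disj S (env Γs π)
      (states S (env Γs π) ((canonLines (literals Γs π) π).take m).reverse))).q (target Γs).q

theorem line_subset {L : Line} (hL : L ∈ π) :
    (L.clause.map fun t => canon (literals Γs π) t) ⊆ (env Γs π).2.1 := fun _ hu =>
  List.mem_dedup.2 (List.mem_append_right _
    (List.mem_flatMap.2 ⟨_, List.mem_map_of_mem hL, hu⟩))

/-- Lines are added in the order of the refutation, but the derivation eliminates them in reverse;
so the part for a new line is put before the derivation for the earlier ones, whose clauses stay
unchanged. -/
theorem correct {S : Setting} (hder : IsDerivation S Γs π) (htree : S = .set → IsTreeLike π) :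
    ∀ m ≤ π.length, Correct S Γs π m := by
  obtain ⟨hwf, -, hfol⟩ := hder
  have hgood : (env Γs π).Good S := env_good hwf
  intro m
  induction m with
  | zero =>
    intro _
    refine ⟨rfl, by simp, ?_⟩
    rw [q_target]
    refine (From.form _).congr rfl ?_
    simp [disj, env, canonHyps, Function.comp_def]
  | succ m ih =>
    intro hm
    obtain ⟨hlen, hlines, hfrom⟩ := ih (by omega)
    have hm' : m < π.length := by omega
    have htake : ((canonLines (literals Γs π) π).take (m + 1)).reverse =
        (π[m].clause.map fun t => canon (literals Γs π) t, π[m].just) ::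
          ((canonLines (literals Γs π) π).take m).reverse := by
      rw [List.take_succ_eq_append_getElem (by simpa [canonLines] using hm')]
      simp [canonLines]
    set l := ((canonLines (literals Γs π) π).take m).reverse with hl
    set xs := states S (env Γs π) l with hxs
    set x : Clause × Justification :=
      (π[m].clause.map fun t => canon (literals Γs π) t, π[m].just) with hx
    have hF := hfol m π[m] (List.getElem?_eq_getElem hm')
    have hmem : π[m] ∈ π := List.getElem_mem hm'
    have hprem : ∀ (i : ℕ) (L : Line), π[i]? = some L → ∀ j ∈ L.just.premisses, j < i := by
      intro i L hi j hj
      have h1 := (hfol i L hi).premisses_lt j hj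
      simp only [List.length_map, List.length_take] at h1
      omega
    have hget : ∀ i < m, ∃ X, xs.reverse[i]? = some X ∧ ∃ L, π[i]? = some L ∧
        S.Le X (canonC (literals Γs π) L.clause.terms) := by
      intro i hi
      have hL : π[i]? = some π[i] := List.getElem?_eq_getElem (by omega)
      obtain ⟨X, h1, h2, -⟩ := hlines i hi _ hL
      exact ⟨X, h1, _, hL, h2⟩
    -- a suitable candidate
    have hhyp : ∀ (r : ℕ) G, (Γs.map Clause.terms)[r]? = some G → ∃ h : Clause × Formula,
        (env Γs π).2.2.2[r]? = some h ∧
        (h.1 : Multiset TermList) = canonC (literals Γs π) G := by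
      intro r G hr
      simp only [List.getElem?_map, Option.map_eq_some_iff] at hr
      obtain ⟨H, hH, rfl⟩ := hr
      exact ⟨(H.map fun t => canon (literals Γs π) t, andL (H.map fun t => orL (negs t))),
        by simp [env, canonHyps, hH], (canonC_terms _ H).symm⟩
    have hcard : Multiset.card π[m].clause.terms = π[m].clause.length := by
      simp [Clause.terms]
    have hcl : ∀ c ∈ cands S (env Γs π) xs π[m].just, c.1.length ≤ π[m].clause.length +
        (π[m].just.premisses.map (lengthAt xs)).sum := by
      intro c hc
      rw [← hcard]
      refine cand_length hF hhyp ?_ hc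
      rintro rfl G hG
      obtain ⟨H, hH, rfl⟩ := List.mem_map.1 hG
      exact hwf H hH
    obtain ⟨c, hc, hcL⟩ := exists_cand hgood hF (xs := xs)
      (by
        intro i Γ hi
        simp only [List.getElem?_map, Option.map_eq_some_iff, List.getElem?_take] at hi
        obtain ⟨L, hL, rfl⟩ := hi
        split at hL
        · obtain ⟨X, h1, h2, -⟩ := hlines i ‹_› L hL
          exact ⟨X, h1, h2⟩
        · simp at hL)
      hhyp
      (by
        intro Γ hΓ s hs a ha
        obtain ⟨L, hL, rfl⟩ := List.mem_map.1 hΓ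
        obtain ⟨t, ht, rfl⟩ := List.mem_map.1 (Multiset.mem_coe.1 hs)
        exact subset_literals_of_line (List.mem_of_mem_take hL) ht ha)
    have hcL' : S.Le c.1 x.1 := by
      have := canonC_terms (literals Γs π) π[m].clause
      change S.Le c.1 (x.1 : Multiset TermList)
      rw [hx, ← this]
      exact hcL
    have hlenAt : ∀ (X : Clause) (i : ℕ), i < m → lengthAt (X :: xs) i = lengthAt xs i := by
      intro X i hi
      rw [lengthAt, lengthAt, List.reverse_cons, List.getElem?_append_left (by simpa [hlen] using hi)]
    have hlenAt' : ∀ X : Clause, lengthAt (X :: xs) m = X.length := by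
      intro X
      rw [lengthAt, List.reverse_cons, List.getElem?_append_right (by simp [hlen])]
      simp [hlen]
    have hsum : ∀ (X : Clause) (i : ℕ) (L : Line), i ≤ m → π[i]? = some L →
        (L.just.premisses.map (lengthAt (X :: xs))).sum =
          (L.just.premisses.map (lengthAt xs)).sum := by
      intro X i L hi hL
      congr 1
      exact List.map_congr_left fun j hj => hlenAt X j (by have := hprem i L hL j hj; omega)
    -- For multisets the line itself bounds the candidate. For sets multiplicities can exceed the
    -- length of the line, and tree-likeness bounds them by the total length.
    have hcap : c.1.length ≤ (env Γs π).2.2.1 := by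
      rw [cap_eq]
      cases S with
      | multiset =>
        have h1 := Multiset.card_le_card (show (c.1 : Multiset TermList) ≤ _ from hcL')
        simp only [Multiset.coe_card, hx, List.length_map] at h1
        exact h1.trans (List.single_le_sum (by simp) _ (List.mem_map_of_mem hmem))
      | set =>
        refine le_trans ?_ (sum_range_getD_le (π.map fun L => L.clause.length) (m + 1))
        have ht : (π.flatMap fun L => L.just.premisses).Nodup := htree rfl
        have := weight_le_of_tree (π.map fun L => L.just.premisses)
          (fun i => (π.map fun L => L.clause.length).getD i 0) (lengthAt (c.1 :: xs))
          (by simpa [List.flatMap_map] using ht) (m := m) (by simpa using hm')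
          (by
            intro i p hp j hj
            simp only [List.getElem?_map, Option.map_eq_some_iff] at hp
            obtain ⟨L, hL, rfl⟩ := hp
            exact hprem i L hL j hj)
          (by
            intro i p hi hp
            simp only [List.getElem?_map, Option.map_eq_some_iff] at hp
            obtain ⟨L, hL, rfl⟩ := hp
            rw [hsum c.1 i L hi hL]
            rcases hi.lt_or_eq with hi | rfl
            · rw [hlenAt _ _ hi]
              obtain ⟨X, h1, -, h3⟩ := hlines i hi L hL
              rw [lengthAt, h1]
              simpa [hL] using h3
            · rw [hlenAt']
              obtain rfl : π[i] = L := by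
                rw [List.getElem?_eq_getElem hm'] at hL
                exact Option.some.inj hL
              simpa [hL] using hcl c hc)
        rwa [hlenAt'] at this
    -- The chosen candidate may differ from `c`; that it passes the test is all that is used from
    -- here on.
    obtain ⟨hch, hfit⟩ := choose_of_exists (x := x) ⟨c, hc, fits_iff.2 ⟨hcL', hcap⟩⟩
    obtain ⟨hfL, -⟩ := fits_iff.1 hfit
    have hsub : ∀ X ∈ xs, X ⊆ (env Γs π).2.1 := by
      intro X hX
      obtain ⟨i, hi, hXi⟩ := List.getElem_of_mem (List.mem_reverse.2 hX)
      have hi' : i < m := by simpa [hlen] using hi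
      obtain ⟨Y, hY, L, hL, hYL⟩ := hget i hi'
      obtain rfl : X = Y := by
        rw [List.getElem?_eq_getElem hi, hXi] at hY
        exact Option.some.inj hY
      rw [canonC_terms] at hYL
      exact List.Subset.trans (fun u hu => hYL.subset hu) (line_subset (List.mem_of_getElem? hL))
    have hΦ := From_cands hgood hsub (line_subset hmem) hch hfL
    refine ⟨?_, ?_, ?_⟩
    · rw [htake]
      simp [states, ← hxs, hlen]
    · intro i hi L hL
      rw [htake]
      simp only [states, ← hxs]
      rw [hsum _ i L (by omega) hL]
      rcases (Nat.lt_succ_iff.1 hi).lt_or_eq with hi | rfl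
      · obtain ⟨X, h1, h2, h3⟩ := hlines i hi L hL
        refine ⟨X, ?_, h2, h3⟩
        rw [List.reverse_cons, List.getElem?_append_left (by simpa [hlen] using hi), h1]
      · obtain rfl : π[i] = L := by
          rw [List.getElem?_eq_getElem hm'] at hL
          exact Option.some.inj hL
        refine ⟨_, ?_, ?_, hcl _ hch⟩
        · rw [List.reverse_cons, List.getElem?_append_right (by simp [hlen])]
          simp [hlen]
        · rw [canonC_terms]
          exact hfL
    · rw [htake]
      simp only [states, translate, ← hxs]
      exact (hΦ.or (.form _)).trans ((From.contr _).trans hfrom)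

theorem simulate_isKSProof {S : Setting} {f : ℕ → ℕ} (href : IsRefutation S f Γs π)
    (htree : S = .set → IsTreeLike π) :
    (simulate S (Γs, π)).IsKSProof (toFormula Γs).dual := by
  obtain ⟨hder, ⟨L, hlast, hL⟩, -⟩ := href
  obtain ⟨hlen, hlines, hfrom⟩ := correct hder htree π.length le_rfl
  rw [List.take_of_length_le (by simp [canonLines])] at hlines hfrom
  have hpos : 0 < π.length := by
    rcases π with _ | ⟨x, l⟩
    · simp at hlast
    · simp
  rw [List.getLast?_eq_getElem?] at hlast
  obtain ⟨X, hX, hXL, -⟩ := hlines (π.length - 1) (by omega) L hlast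
  -- The clause kept for the last line is contained in the empty clause, so its dual is ⊤.
  obtain rfl : X = [] := by
    rw [hL] at hXL
    rw [List.eq_nil_iff_forall_not_mem]
    intro u hu
    have := hXL.subset hu
    simp [canonC, Clause.terms] at this
  have h1 : (embed (clauseF S (env Γs π).2.1 []) _).From 1 _ :=
    (From_embed_clause (List.mem_reverse.1 (List.mem_of_getElem? hX))).congr
      (clauseF_nil S _) rfl
  obtain ⟨hks, -, -⟩ := (From.form .top).trans ((h1.trans hfrom).trans (.form _))
  exact ⟨hks, rfl, target_eq Γs⟩

end

end DeepInf

theorem mainTheorem6 (f : ℕ → ℕ) :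
    DeepInf.KSPolySimulates (DeepInf.MultisetRes f) ∧
    DeepInf.KSPolySimulates (DeepInf.TreeLikeRes f) :=
  ⟨DeepInf.ksPolySimulates_of_simulate fun _ _ h =>
    DeepInf.simulate_isKSProof h (fun h => nomatch h),
  DeepInf.ksPolySimulates_of_simulate fun _ _ h =>
    DeepInf.simulate_isKSProof h.1 (fun _ => h.2)⟩
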